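/- Let $\lambda,c_1,c_2,P,\sigma_0,\beta>0$, $\alpha>2$, $\ell\in[0,1]$ and let $N\ge 1$ be an integer. UAVs are located at $U_i=(X_i,H_i)\in\mathbb{R}^2\times[0,\infty)$, $i\in\mathbb{N}$, where the projections $X_i$ form a homogeneous planar Poisson point process of density $\lambda$ and the altitudes $H_i$ are i.i.d. copies of a random variable $H\ge 0$, independent of the projections (APDL scenario). Let $\Theta_i=\arctan(H_i/\|X_i\|)$ be the elevation angle of $U_i$ and $\rho(\theta)=1/(1+c_2e^{-c_1\theta})$. Given all locations, the link from $U_i$ to the origin is line-of-sight with probability $\rho(\Theta_i)$, independently for different $i$; put $L_i=1$ if it is line-of-sight and $L_i=\ell$ otherwise. The fading gains $G_i\sim\mathrm{Gamma}(N,1)$ (shape $N$, rate $1$) are i.i.d. and independent of all locations and links. For $x\ge 0$ and a random angle $Y\in[0,\pi/2]$ let $$\mathcal{J}_G(x,Y)=1-\mathbb{E}_Y\Big\{\rho(Y)\Big(1+\frac{x\cos^\alpha Y}{N}\Big)^{-N}+[1-\rho(Y)]\Big(1+\frac{x\ell\cos^\alpha Y}{N}\Big)^{-N}\Big\}.$$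 Then $\sum_i G_iL_i\|U_i\|^{-\alpha}<\infty$ almost surely, the integral below converges for every $s>0$, and $$\Psi(s)=\frac1s\exp\Big[-\pi\lambda\int_0^\infty \mathcal{J}_G\big(sz^{-\alpha/2},\arctan(H/\sqrt z)\big)\,dz\Big],\qquad s>0,$$ has an inverse Laplace transform $\mathcal{L}^{-1}\{\Psi\}$, namely a function continuous on $(0,\infty)$ whose Laplace transform is $\Psi(s)$ for all $s>0$ (such a function is unique on $(0,\infty)$). The cell-free downlink coverage under non-coherent joint transmission is, for the gains $G_i/N\sim\mathrm{Gamma}(N,N)$ of unit mean, $$\mathbb{P}\Big[\frac{P\sum_i (G_i/N)L_i\|U_i\|^{-\alpha}}{\sigma_0}\ge\beta\Big]=1-\mathcal{L}^{-1}\{\Psi\}\Big(\frac{\beta\sigma_0}{P}\Big),$$ and, for the gains $G_i\sim\mathrm{Gamma}(N,1)$ themselves, $$\mathbb{P}\Big[\frac{P\sum_i G_iL_i\|U_i\|^{-\alpha}}{\sigma_0}\ge\beta\Big]=1-\mathcal{L}^{-1}\{\Psi\}\Big(\frac{\beta\sigma_0}{NP}\Big).$$ Moreover, for every $x\ge 0$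 and every random angle $Y\in[0,\pi/2]$, $$\lim_{N\to\infty}\mathcal{J}_G(x,Y)=1-\mathbb{E}_Y\big\{\rho(Y)e^{-x\cos^\alpha Y}+[1-\rho(Y)]e^{-x\ell\cos^\alpha Y}\big\}.$$ -/

import Mathlib

open MeasureTheory ProbabilityTheory Filter Topology Set
open scoped ENNReal NNReal

noncomputable section

namespace CellFree

/-- The ground plane with its Euclidean norm. -/
abbrev Plane : Type := EuclideanSpace ℝ (Fin 2)

/-- The number (possibly infinite) of points of the enumerated configuration `x` in `B`. -/
def countIn {E : Type*} (x : ℕ → E) (B : Set E) : ℕ∞ := {i : ℕ | x i ∈ B}.encard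

/-- The random points `X 0, X 1, …` enumerate a Poisson point process with intensity measure `Λ`:
the number of points in a measurable set of finite intensity is Poisson distributed, and the
numbers of points in finitely many pairwise disjoint such sets are independent. -/
structure IsPoissonPointProcess {Ω E : Type*} [MeasurableSpace Ω] [MeasurableSpace E]
    (X : ℕ → Ω → E) (Λ : Measure E) (μ : Measure Ω) : Prop where
  measurable : ∀ i, Measurable (X i)
  count_law : ∀ B : Set E, MeasurableSet B → Λ B ≠ ∞ →
    μ.map (fun ω => countIn (fun i => X i ω) B) =
      (poissonMeasure (Λ B).toNNReal).map (Nat.cast : ℕ → ℕ∞)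
  count_indep : ∀ (n : ℕ) (B : Fin n → Set E), (∀ j, MeasurableSet (B j)) →
    (∀ j, Λ (B j) ≠ ∞) → Pairwise (fun j k => Disjoint (B j) (B k)) →
    iIndepFun (fun j ω => countIn (fun i => X i ω) (B j)) μ

/-- Line-of-sight probability at elevation angle `θ`. -/
def losProb (c₁ c₂ θ : ℝ) : ℝ := 1 / (1 + c₂ * Real.exp (-c₁ * θ))

/-- The position in three-dimensional space (with the Euclidean norm) of the point with
projection `x` and altitude `h`. -/
def position (x : Plane) (h : ℝ) : WithLp 2 (Plane × ℝ) := WithLp.toLp 2 (x, h)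

/-- The elevation angle, seen from the origin, of the point with projection `x` and altitude
`h`. -/
def elevation (x : Plane) (h : ℝ) : ℝ := Real.arctan (h / ‖x‖)

/-- The attenuation factor of a link: `1` with line of sight and `ℓ` without. -/
def linkFactor (ℓ : ℝ) (b : Bool) : ℝ := if b then 1 else ℓ

/-- The network model. UAV `i` has projection `X i` and altitude `H i`; `B i` says whether its
link to the origin is line-of-sight, and `G i` is its fading gain.
The projections form a homogeneous planar Poisson process of density `lam`; the altitudes are
i.i.d. with law `η` on `[0, ∞)` and independent of the projections; given all projections and
altitudes, the links are independently line-of-sight with probability `losProb` of their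
elevation angle; the gains are i.i.d. `Gamma(N, 1)` and independent of everything else. -/
structure IsAPDLNetwork {Ω : Type*} [MeasurableSpace Ω] (μ : Measure Ω) (lam : ℝ)
    (η : Measure ℝ) (c₁ c₂ : ℝ) (N : ℕ)
    (X : ℕ → Ω → Plane) (H : ℕ → Ω → ℝ) (B : ℕ → Ω → Bool) (G : ℕ → Ω → ℝ) : Prop where
  projections : IsPoissonPointProcess X (ENNReal.ofReal lam • (volume : Measure Plane)) μ
  measurable_altitude : ∀ i, Measurable (H i)
  altitude_law : ∀ i, μ.map (H i) = η
  altitude_nonneg : ∀ᵐ h ∂η, 0 ≤ h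
  altitude_indep : iIndepFun H μ
  altitude_projection_indep : IndepFun (fun ω i => X i ω) (fun ω i => H i ω) μ
  measurable_los : ∀ i, Measurable (B i)
  los_law : ∀ S : Finset ℕ,
    μ[fun ω => ∏ i ∈ S, (if B i ω then (1 : ℝ) else 0) |
        MeasurableSpace.comap (fun ω i => (X i ω, H i ω)) inferInstance]
      =ᵐ[μ] fun ω => ∏ i ∈ S, losProb c₁ c₂ (elevation (X i ω) (H i ω))
  measurable_gain : ∀ i, Measurable (G i)
  gain_law : ∀ i, μ.map (G i) = gammaMeasure N 1
  gain_indep : iIndepFun G μ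
  gain_indep_rest : IndepFun (fun ω i => (X i ω, H i ω, B i ω)) (fun ω i => G i ω) μ

/-- The contribution `G_i L_i ‖U_i‖ ^ (-α)` of UAV `i` to the received signal. -/
def signal {Ω : Type*} (α ℓ : ℝ) (X : ℕ → Ω → Plane) (H : ℕ → Ω → ℝ) (B : ℕ → Ω → Bool)
    (G : ℕ → Ω → ℝ) (i : ℕ) (ω : Ω) : ℝ :=
  G i ω * linkFactor ℓ (B i ω) * ‖position (X i ω) (H i ω)‖ ^ (-α)

/-- The cell-free downlink coverage: the probability that the signal-to-noise ratio under
non-coherent joint transmission by all UAVs is at least `β`. -/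
def cellFreeCoverage {Ω : Type*} [MeasurableSpace Ω] (μ : Measure Ω) (P σ₀ β α ℓ : ℝ)
    (X : ℕ → Ω → Plane) (H : ℕ → Ω → ℝ) (B : ℕ → Ω → Bool) (G : ℕ → Ω → ℝ) : ℝ :=
  μ.real {ω | P * (∑' i, signal α ℓ X H B G i ω) / σ₀ ≥ β}

/-- `J_G(x, Y)` for a random angle `Y` with law `ν`. -/
def JG (c₁ c₂ α ℓ : ℝ) (N : ℕ) (x : ℝ) (ν : Measure ℝ) : ℝ :=
  1 - ∫ y, (losProb c₁ c₂ y * (1 + x * Real.cos y ^ α / N) ^ (-(N : ℤ))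
    + (1 - losProb c₁ c₂ y) * (1 + x * Real.cos y ^ α * ℓ / N) ^ (-(N : ℤ))) ∂ν

/-- The law of the angle `arctan (H / √z)` for a random altitude `H` with law `η`. -/
def angleLaw (η : Measure ℝ) (z : ℝ) : Measure ℝ :=
  η.map (fun h => Real.arctan (h / Real.sqrt z))

/-- The function `s ↦ (1 / s) exp [-π λ ∫_0^∞ J_G(s z ^ (-α / 2), arctan (H / √z)) dz]`. -/
def coverageTransform (lam : ℝ) (η : Measure ℝ) (c₁ c₂ α ℓ : ℝ) (N : ℕ) (s : ℝ) : ℝ :=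
  1 / s * Real.exp (-(Real.pi * lam *
    ∫ z in Ioi (0 : ℝ), JG c₁ c₂ α ℓ N (s * z ^ (-(α / 2))) (angleLaw η z)))

/-- `f` is an inverse Laplace transform of `g`: it is continuous on `(0, ∞)` and its Laplace
transform converges to `g s` for every `s > 0`. By Lerch's theorem there is at most one such
function on `(0, ∞)`. -/
def IsInverseLaplace (g f : ℝ → ℝ) : Prop :=
  ContinuousOn f (Ioi 0) ∧ ∀ s > 0,
    IntegrableOn (fun t => Real.exp (-s * t) * f t) (Ioi 0) ∧
      ∫ t in Ioi (0 : ℝ), Real.exp (-s * t) * f t = g s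

open Classical in
/-- The inverse Laplace transform of `g`, as a function on `(0, ∞)` (zero if there is none). -/
def inverseLaplace (g : ℝ → ℝ) : ℝ → ℝ :=
  if h : ∃ f, IsInverseLaplace g f then h.choose else 0

end CellFree

end

open CellFree

/-
Let `Z` be the received signal for the gains `G i / N`. Integrating `exp (-s Z)` successively over
the gains, the link states and the altitudes leaves the expectation of a product `∏ φ (X i)` over
the points of a planar Poisson process, which the probability generating functional and the
substitution `z = r ^ 2` in polar coordinates turn into `exp (-π λ ∫ J_G)`, that is, `s Ψ(s)`.
As `s → 0` this expectation tends to `1`, so `Z` is almost surely finite.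
Conditionally on everything but one gain, `Z` is an affine function of a gamma variable, so its law
has no atom in `(0, ∞)`; hence its distribution function is continuous there, with Laplace transform
`Ψ`. By Lerch's theorem it is the inverse Laplace transform of `Ψ`, and the coverage is its tail.
-/

namespace CellFree

section InfiniteProduct

variable {ι : Type*} {a : ι → ℝ≥0∞}

lemma tprod_le_one (ha : ∀ i, a i ≤ 1) : ∏' i, a i ≤ 1 := by
  rw [ENNReal.tprod_eq_iInf_prod ha]
  exact (iInf_le _ ∅).trans_eq Finset.prod_empty

lemma tprod_mono_of_le_one {b : ι → ℝ≥0∞} (hb : ∀ i, b i ≤ 1) (hab : ∀ i, a i ≤ b i) :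
    ∏' i, a i ≤ ∏' i, b i := by
  rw [ENNReal.tprod_eq_iInf_prod fun i => (hab i).trans (hb i), ENNReal.tprod_eq_iInf_prod hb]
  exact iInf_mono fun s => Finset.prod_le_prod' fun i _ => hab i

lemma measurable_tprod_of_le_one [Countable ι] {Ω : Type*} [MeasurableSpace Ω]
    {f : ι → Ω → ℝ≥0∞} (hf : ∀ i, Measurable (f i)) (hle : ∀ i ω, f i ω ≤ 1) :
    Measurable fun ω => ∏' i, f i ω := by
  simp only [fun ω => ENNReal.tprod_eq_iInf_prod fun i => hle i ω]
  exact Measurable.iInf fun s => Finset.measurable_fun_prod s fun i _ => hf i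

lemma tendsto_lintegral_finsetProd [Countable ι] {Ω : Type*} [MeasurableSpace Ω]
    {μ : Measure Ω} [IsFiniteMeasure μ] {f : ι → Ω → ℝ≥0∞} (hf : ∀ i, Measurable (f i))
    (hle : ∀ᵐ ω ∂μ, ∀ i, f i ω ≤ 1) :
    Tendsto (fun s : Finset ι => ∫⁻ ω, ∏ i ∈ s, f i ω ∂μ) atTop
      (𝓝 (∫⁻ ω, ∏' i, f i ω ∂μ)) := by
  refine tendsto_lintegral_filter_of_dominated_convergence (fun _ => 1)
    (Eventually.of_forall fun s => Finset.measurable_fun_prod s fun i _ => hf i)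
    (Eventually.of_forall fun s => hle.mono fun ω hω => Finset.prod_le_one' fun i _ => hω i)
    (by simp) (hle.mono fun ω hω => ?_)
  exact (ENNReal.multipliable_of_le_one hω).hasProd

lemma tprod_iInf_of_antitone {a : ℕ → ι → ℝ≥0∞} (ha : ∀ k i, a k i ≤ 1)
    (hanti : ∀ i, Antitone fun k => a k i) : ∏' i, ⨅ k, a k i = ⨅ k, ∏' i, a k i := by
  have hfinite (s : Finset ι) : ∏ i ∈ s, ⨅ k, a k i = ⨅ k, ∏ i ∈ s, a k i :=
    tendsto_nhds_unique
      (ENNReal.tendsto_finsetProd_of_ne_top s (fun i _ => tendsto_atTop_iInf (hanti i))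
        fun i _ => ne_top_of_le_ne_top ENNReal.one_ne_top ((iInf_le _ 0).trans (ha 0 i)))
      (tendsto_atTop_iInf fun k l hkl => Finset.prod_le_prod' fun i _ => hanti i hkl)
  rw [ENNReal.tprod_eq_iInf_prod fun i => (iInf_le _ 0).trans (ha 0 i)]
  simp only [hfinite, fun k => ENNReal.tprod_eq_iInf_prod (ha k)]
  exact iInf_comm

lemma tprod_finsetProd_of_le_one {κ : Type*} {s : Finset κ} {a : κ → ι → ℝ≥0∞}
    (ha : ∀ j i, a j i ≤ 1) : ∏' i, ∏ j ∈ s, a j i = ∏ j ∈ s, ∏' i, a j i := by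
  refine HasProd.tprod_eq ?_
  simp only [HasProd, Finset.prod_comm (t := s)]
  exact ENNReal.tendsto_finsetProd_of_ne_top s
    (fun j _ => (ENNReal.multipliable_of_le_one (ha j)).hasProd)
    fun j _ => ne_top_of_le_ne_top ENNReal.one_ne_top (tprod_le_one (ha j))

lemma tprod_ite_mem_eq_pow_countIn {E : Type*} {x : ℕ → E} {B : Set E}
    (hfin : {i | x i ∈ B}.Finite) [DecidablePred (· ∈ B)] (c : ℝ≥0∞) :
    ∏' i, (if x i ∈ B then c else 1) = c ^ (countIn x B).toNat := by
  rw [tprod_eq_prod (s := hfin.toFinset) fun i hi => if_neg (by simpa using hi),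
    Finset.prod_congr rfl fun i hi => if_pos (by simpa using hi), Finset.prod_const, countIn,
    hfin.encard_eq_coe_toFinset_card, ENat.toNat_natCast]

lemma tprod_prod_ite_mem_eq_prod_pow_countIn {E κ : Type*} [Fintype κ] {x : ℕ → E}
    {B : κ → Set E} (hfin : ∀ j, {i | x i ∈ B j}.Finite) [∀ j, DecidablePred (· ∈ B j)]
    {c : κ → ℝ≥0∞} (hc : ∀ j, c j ≤ 1) :
    ∏' i, ∏ j, (if x i ∈ B j then c j else 1) = ∏ j, c j ^ (countIn x (B j)).toNat := by
  rw [tprod_finsetProd_of_le_one fun j i => by split_ifs; exacts [hc j, le_rfl]]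
  exact Finset.prod_congr rfl fun j _ => tprod_ite_mem_eq_pow_countIn (hfin j) (c j)

end InfiniteProduct

section PoissonFunctional

lemma lintegral_pow_poissonMeasure (r z : ℝ≥0) :
    ∫⁻ n : ℕ, (z : ℝ≥0∞) ^ n ∂(poissonMeasure r) = ENNReal.ofReal (Real.exp (r * (z - 1))) := by
  have hterm (n : ℕ) : ENNReal.ofReal (Real.exp (-r) * r ^ n / n.factorial) * (z : ℝ≥0∞) ^ n
      = ENNReal.ofReal (Real.exp (-r) * ((r * z : ℝ) ^ n / n.factorial)) := by
    rw [← ENNReal.ofReal_coe_nnreal, ← ENNReal.ofReal_pow z.coe_nonneg,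
      ← ENNReal.ofReal_mul (by positivity), mul_pow]
    ring_nf
  have hsum : HasSum (fun n : ℕ => Real.exp (-r) * ((r * z : ℝ) ^ n / n.factorial))
      (Real.exp (-r) * Real.exp (r * z)) := by
    rw [Real.exp_eq_exp_ℝ]
    exact (NormedSpace.expSeries_div_hasSum_exp (𝔸 := ℝ) _).mul_left _
  rw [poissonMeasure, lintegral_sum_measure]
  simp only [lintegral_smul_measure, lintegral_dirac, smul_eq_mul, hterm]
  rw [← ENNReal.ofReal_tsum_of_nonneg (fun n => by positivity) hsum.summable, hsum.tsum_eq,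
    ← Real.exp_add]
  ring_nf

namespace IsPoissonPointProcess

variable {Ω E : Type*} [MeasurableSpace Ω] [MeasurableSpace E] {X : ℕ → Ω → E} {Λ : Measure E}
  {μ : Measure Ω}

lemma measurable_countIn (h : IsPoissonPointProcess X Λ μ) {B : Set E} (hB : MeasurableSet B) :
    Measurable fun ω => countIn (fun i => X i ω) B :=
  measurable_encard.comp
    (measurable_set_iff.2 fun i => (measurable_mem.2 hB).comp (h.measurable i))

lemma lintegral_countIn (h : IsPoissonPointProcess X Λ μ) {B : Set E} (hB : MeasurableSet B)
    (hΛ : Λ B ≠ ∞) (f : ℕ∞ → ℝ≥0∞) :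
    ∫⁻ ω, f (countIn (fun i => X i ω) B) ∂μ
      = ∫⁻ n : ℕ, f n ∂(poissonMeasure (Λ B).toNNReal) := by
  rw [← lintegral_map (f := f) Measurable.of_discrete (h.measurable_countIn hB),
    h.count_law B hB hΛ, lintegral_map Measurable.of_discrete Measurable.of_discrete]

lemma ae_finite_mem (h : IsPoissonPointProcess X Λ μ) {B : Set E} (hB : MeasurableSet B)
    (hΛ : Λ B ≠ ∞) : ∀ᵐ ω ∂μ, {i | X i ω ∈ B}.Finite := by
  have hlaw : ∀ᵐ n ∂μ.map fun ω => countIn (fun i => X i ω) B, n ≠ ⊤ := by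
    rw [h.count_law B hB hΛ]
    exact (ae_map_iff Measurable.of_discrete.aemeasurable .of_discrete).2
      (Eventually.of_forall ENat.natCast_ne_top)
  filter_upwards [ae_of_ae_map (h.measurable_countIn hB).aemeasurable hlaw] with ω hω
  exact Set.encard_ne_top_iff.1 hω

lemma iIndepFun_countIn (h : IsPoissonPointProcess X Λ μ) {ι : Type*} [Finite ι]
    {B : ι → Set E} (hB : ∀ j, MeasurableSet (B j)) (hΛ : ∀ j, Λ (B j) ≠ ∞)
    (hdisj : Pairwise fun j k => Disjoint (B j) (B k)) :
    iIndepFun (fun j ω => countIn (fun i => X i ω) (B j)) μ := by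
  obtain ⟨n, ⟨e⟩⟩ := Finite.exists_equiv_fin ι
  have hFin := h.count_indep _ (fun j => B (e.symm j)) (fun _ => hB _) (fun _ => hΛ _)
    (fun _ _ hjk => hdisj (e.symm.injective.ne hjk))
  simpa using hFin.precomp e.injective

lemma lintegral_prod_pow_countIn (h : IsPoissonPointProcess X Λ μ) {ι : Type*} [Fintype ι]
    {B : ι → Set E} (hB : ∀ j, MeasurableSet (B j)) (hΛ : ∀ j, Λ (B j) ≠ ∞)
    (hdisj : Pairwise fun j k => Disjoint (B j) (B k)) (z : ι → ℝ≥0) :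
    ∫⁻ ω, ∏ j, (z j : ℝ≥0∞) ^ (countIn (fun i => X i ω) (B j)).toNat ∂μ
      = ENNReal.ofReal (Real.exp (∑ j, (Λ (B j)).toReal * (z j - 1))) := by
  have hpow (j) : Measurable fun n : ℕ∞ => (z j : ℝ≥0∞) ^ n.toNat := .of_discrete
  have hindep := (h.iIndepFun_countIn hB hΛ hdisj).comp _ hpow
  have hfactor (j) : ∫⁻ ω, (z j : ℝ≥0∞) ^ (countIn (fun i => X i ω) (B j)).toNat ∂μ
      = ENNReal.ofReal (Real.exp ((Λ (B j)).toReal * (z j - 1))) := by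
    rw [h.lintegral_countIn (hB j) (hΛ j) fun n => (z j : ℝ≥0∞) ^ n.toNat]
    exact lintegral_pow_poissonMeasure _ _
  rw [Real.exp_sum, ENNReal.ofReal_prod_of_nonneg fun _ _ => (Real.exp_pos _).le,
    ← Finset.prod_congr rfl fun j _ => hfactor j]
  exact lintegral_prod_eq_prod_lintegral_of_indepFun Finset.univ _ hindep
    fun j => (hpow j).comp (h.measurable_countIn (hB j))

lemma lintegral_tprod_one_sub_simpleFunc (h : IsPoissonPointProcess X Λ μ)
    (φ : SimpleFunc E ℝ≥0∞) (hle : ∀ x, φ x ≤ 1) (hfin : φ.lintegral Λ ≠ ∞) :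
    ∫⁻ ω, ∏' i, (1 - φ (X i ω)) ∂μ = ENNReal.ofReal (Real.exp (-(φ.lintegral Λ).toReal)) := by
  classical
  -- `1 - φ` is constant on each level set of `φ`, and the numbers of points in the level sets are
  -- independent Poisson variables.
  let V : Finset ℝ≥0∞ := φ.range.filter (· ≠ 0)
  have hV_le (v : V) : v.1 ≤ 1 := by
    obtain ⟨x, hx⟩ := SimpleFunc.mem_range.1 (Finset.mem_filter.1 v.2).1
    exact hx ▸ hle x
  have hV_top (v : V) : v.1 ≠ ∞ := ne_top_of_le_ne_top ENNReal.one_ne_top (hV_le v)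
  have hV_meas (v : V) : MeasurableSet (φ ⁻¹' {v.1}) := φ.measurableSet_preimage _
  have hV_fin (v : V) : Λ (φ ⁻¹' {v.1}) ≠ ∞ :=
    (SimpleFunc.finMeasSupp_iff.1 (.of_lintegral_ne_top hfin) v (Finset.mem_filter.1 v.2).2).ne
  have hV_disj : Pairwise fun v w : V => Disjoint (φ ⁻¹' {v.1}) (φ ⁻¹' {w.1}) := fun v w hvw =>
    (Set.disjoint_singleton.2 fun hval => hvw (Subtype.ext hval)).preimage φ
  have hone_sub (x : E) : 1 - φ x = ∏ v : V, if x ∈ φ ⁻¹' {v.1} then 1 - v.1 else 1 := by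
    rw [Finset.prod_coe_sort V fun v => if x ∈ φ ⁻¹' {v} then 1 - v else 1]
    simp only [mem_preimage, mem_singleton_iff, Finset.prod_ite_eq, V, Finset.mem_filter,
      SimpleFunc.mem_range_self, true_and]
    split_ifs with hx <;> simp_all
  have hprod : ∀ᵐ ω ∂μ, ∏' i, (1 - φ (X i ω)) =
      ∏ v : V, ((1 - v.1.toNNReal : ℝ≥0) : ℝ≥0∞) ^
        (countIn (fun i => X i ω) (φ ⁻¹' {v.1})).toNat := by
    filter_upwards [ae_all_iff.2 fun v => h.ae_finite_mem (hV_meas v) (hV_fin v)] with ω hω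
    simp only [hone_sub, tprod_prod_ite_mem_eq_prod_pow_countIn hω fun _ => tsub_le_self,
      ENNReal.coe_sub, ENNReal.coe_one, ENNReal.coe_toNNReal (hV_top _)]
  have hsum : (φ.lintegral Λ).toReal = ∑ v : V, v.1.toReal * (Λ (φ ⁻¹' {v.1})).toReal := by
    rw [Finset.sum_coe_sort V fun v => v.toReal * (Λ (φ ⁻¹' {v})).toReal,
      Finset.sum_filter_of_ne fun _ _ => by contrapose!; rintro rfl; simp, SimpleFunc.lintegral,
      ENNReal.toReal_sum fun v hv => (ENNReal.lt_top_of_sum_ne_top hfin hv).ne]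
    simp only [ENNReal.toReal_mul]
  rw [lintegral_congr_ae hprod, h.lintegral_prod_pow_countIn hV_meas hV_fin hV_disj, hsum,
    ← Finset.sum_neg_distrib]
  congr 2
  refine Finset.sum_congr rfl fun v _ => ?_
  have hle_one : v.1.toNNReal ≤ 1 :=
    ENNReal.coe_le_one_iff.1 (ENNReal.coe_toNNReal_le_self.trans (hV_le v))
  rw [NNReal.coe_sub hle_one, NNReal.coe_one, ENNReal.coe_toNNReal_eq_toReal]
  ring

lemma lintegral_tprod (h : IsPoissonPointProcess X Λ μ) [IsProbabilityMeasure μ]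
    {u : E → ℝ≥0∞} (hu : Measurable u) (hle : ∀ x, u x ≤ 1) (hfin : ∫⁻ x, 1 - u x ∂Λ ≠ ∞) :
    ∫⁻ ω, ∏' i, u (X i ω) ∂μ = ENNReal.ofReal (Real.exp (-(∫⁻ x, 1 - u x ∂Λ).toReal)) := by
  have hφ : Measurable fun x => 1 - u x := hu.const_sub 1
  let φ (k : ℕ) : SimpleFunc E ℝ≥0∞ := SimpleFunc.eapprox (fun x => 1 - u x) k
  have hφ_mono : Monotone φ := SimpleFunc.monotone_eapprox _
  have hφ_le (k : ℕ) (x : E) : φ k x ≤ 1 - u x :=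
    (le_iSup (fun k => φ k x) k).trans_eq (SimpleFunc.iSup_eapprox_apply hφ x)
  have hφ_iInf (x : E) : u x = ⨅ k, (1 - φ k x) := by
    rw [← ENNReal.sub_iSup ENNReal.one_ne_top, SimpleFunc.iSup_eapprox_apply hφ x,
      ENNReal.sub_sub_cancel ENNReal.one_ne_top (hle x)]
  have hφ_lintegral : Tendsto (fun k => (φ k).lintegral Λ) atTop (𝓝 (∫⁻ x, 1 - u x ∂Λ)) := by
    rw [lintegral_eq_iSup_eapprox_lintegral hφ]
    exact tendsto_atTop_iSup fun k l hkl => SimpleFunc.lintegral_mono (hφ_mono hkl) le_rfl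
  have hφ_fin (k : ℕ) : (φ k).lintegral Λ ≠ ∞ := by
    rw [← SimpleFunc.lintegral_eq_lintegral]
    exact ne_top_of_le_ne_top hfin (lintegral_mono (hφ_le k))
  have hprod_anti : Antitone fun k ω => ∏' i, (1 - φ k (X i ω)) := fun k l hkl ω =>
    tprod_mono_of_le_one (fun _ => tsub_le_self) fun i => tsub_le_tsub_left (hφ_mono hkl _) 1
  have hprod_meas (k : ℕ) : Measurable fun ω => ∏' i, (1 - φ k (X i ω)) :=
    measurable_tprod_of_le_one (fun i => ((φ k).measurable.comp (h.measurable i)).const_sub 1)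
      fun _ _ => tsub_le_self
  have hlim : Tendsto (fun k => ∫⁻ ω, ∏' i, (1 - φ k (X i ω)) ∂μ) atTop
      (𝓝 (∫⁻ ω, ∏' i, u (X i ω) ∂μ)) := by
    simp only [hφ_iInf, fun ω => tprod_iInf_of_antitone (a := fun k i => 1 - φ k (X i ω))
      (fun _ _ => tsub_le_self) fun _ _ _ hkl => tsub_le_tsub_left (hφ_mono hkl _) 1]
    rw [lintegral_iInf hprod_meas hprod_anti]
    · exact tendsto_atTop_iInf fun k l hkl => lintegral_mono (hprod_anti hkl)
    · refine ne_top_of_le_ne_top ENNReal.one_ne_top ?_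
      exact (lintegral_mono fun ω => tprod_le_one fun _ => tsub_le_self).trans_eq (by simp)
  refine tendsto_nhds_unique hlim ?_
  simp only [fun k => h.lintegral_tprod_one_sub_simpleFunc (φ k)
    (fun x => (hφ_le k x).trans tsub_le_self) (hφ_fin k)]
  exact ENNReal.tendsto_ofReal ((Real.continuous_exp.tendsto _).comp
    ((ENNReal.tendsto_toReal hfin).comp hφ_lintegral).neg)

end IsPoissonPointProcess

end PoissonFunctional

section Independence

variable {Ω E F ι : Type*} [MeasurableSpace Ω] [MeasurableSpace E] [MeasurableSpace F]
  {μ : Measure Ω} [IsProbabilityMeasure μ]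

lemma lintegral_prodMk_of_indepFun {V : Ω → E} {W : Ω → F} (hV : Measurable V)
    (hW : Measurable W) (hVW : IndepFun V W μ) {f : E × F → ℝ≥0∞} (hf : Measurable f) :
    ∫⁻ ω, f (V ω, W ω) ∂μ = ∫⁻ ω, ∫⁻ ω', f (V ω, W ω') ∂μ ∂μ := by
  have := Measure.isProbabilityMeasure_map (μ := μ) hW.aemeasurable
  rw [← lintegral_map hf (hV.prodMk hW),
    (indepFun_iff_map_prod_eq_prod_map_map hV.aemeasurable hW.aemeasurable).1 hVW,
    lintegral_prod _ hf.aemeasurable, lintegral_map hf.lintegral_prod_right' hV]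
  exact lintegral_congr fun ω => lintegral_map (hf.comp measurable_prodMk_left) hW

lemma measure_prodMk_mem_eq_zero_of_indepFun {V : Ω → E} {W : Ω → F} (hV : Measurable V)
    (hW : Measurable W) (hVW : IndepFun V W μ) {A : Set (E × F)} (hA : MeasurableSet A)
    (hnull : ∀ v, μ {ω | (v, W ω) ∈ A} = 0) : μ {ω | (V ω, W ω) ∈ A} = 0 := by
  have hmeas {V' : Ω → E} (hV' : Measurable V') :
      ∫⁻ ω, A.indicator 1 (V' ω, W ω) ∂μ = μ {ω | (V' ω, W ω) ∈ A} :=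
    lintegral_indicator_one (hV'.prodMk hW hA)
  rw [← hmeas hV, lintegral_prodMk_of_indepFun hV hW hVW (measurable_one.indicator hA)]
  simp only [hmeas measurable_const, hnull, lintegral_zero]

lemma lintegral_prod_of_indep_marks [Countable ι] {V : ι → Ω → E} {W : ι → Ω → F}
    {η : Measure F} (hV : ∀ i, Measurable (V i)) (hW : ∀ i, Measurable (W i))
    (hlaw : ∀ i, μ.map (W i) = η) (hindep : iIndepFun W μ)
    (hVW : IndepFun (fun ω i => V i ω) (fun ω i => W i ω) μ)
    {k : E → F → ℝ≥0∞} (hk : Measurable (Function.uncurry k)) (s : Finset ι) :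
    ∫⁻ ω, ∏ i ∈ s, k (V i ω) (W i ω) ∂μ = ∫⁻ ω, ∏ i ∈ s, ∫⁻ w, k (V i ω) w ∂η ∂μ := by
  have hprod : Measurable fun p : (ι → E) × (ι → F) => ∏ i ∈ s, k (p.1 i) (p.2 i) :=
    Finset.measurable_fun_prod s fun i _ =>
      hk.comp (f := fun p : (ι → E) × (ι → F) => (p.1 i, p.2 i)) (by fun_prop)
  rw [lintegral_prodMk_of_indepFun (measurable_pi_iff.2 hV) (measurable_pi_iff.2 hW) hVW hprod]
  refine lintegral_congr fun ω => ?_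
  have hk_left (i : ι) : Measurable (k (V i ω)) := hk.comp measurable_prodMk_left
  calc ∫⁻ ω', ∏ i ∈ s, k (V i ω) (W i ω') ∂μ = ∏ i ∈ s, ∫⁻ ω', k (V i ω) (W i ω') ∂μ :=
        lintegral_prod_eq_prod_lintegral_of_indepFun s _ (hindep.comp _ hk_left)
          fun i => (hk_left i).comp (hW i)
    _ = ∏ i ∈ s, ∫⁻ w, k (V i ω) w ∂η := Finset.prod_congr rfl fun i _ => by
        rw [← hlaw i, lintegral_map (hk_left i) (hW i)]

end Independence

section NoAtoms

lemma measurable_tsum_ite_ne {Ω ι : Type*} [Countable ι] [DecidableEq ι] {m : MeasurableSpace Ω}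
    {W : ι → Ω → ℝ≥0∞} {i : ι} (hW : ∀ j ≠ i, Measurable (W j)) (c : ι → ℝ≥0∞) :
    Measurable fun ω => ∑' j, if j = i then 0 else c j * W j ω :=
  Measurable.tsum fun j => by
    split_ifs with hj
    exacts [measurable_const, (hW j hj).const_mul _]

variable {Ω ι : Type*} [MeasurableSpace Ω] {μ : Measure Ω}

lemma measure_mul_add_eq_zero [IsProbabilityMeasure μ] {R W : Ω → ℝ≥0∞}
    (hR : Measurable R) (hW : Measurable W)
    (hRW : IndepFun R W μ) (hatom : ∀ x, μ {ω | W ω = x} = 0) {c t : ℝ≥0∞} (hc : c ≠ 0)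
    (ht : t ≠ ∞) : μ {ω | c * W ω + R ω = t} = 0 := by
  refine measure_prodMk_mem_eq_zero_of_indepFun (A := {p : ℝ≥0∞ × ℝ≥0∞ | c * p.2 + p.1 = t})
    hR hW hRW ((by fun_prop : Measurable fun p : ℝ≥0∞ × ℝ≥0∞ => c * p.2 + p.1)
      (measurableSet_singleton t)) fun r => ?_
  have hsub : {w | c * w + r = t}.Subsingleton := fun w hw w' hw' => by
    have hr : r ≠ ∞ := by rintro rfl; simp_all
    have hcw : c * w ≠ ∞ := fun hcw => ht (by rw [← hw, hcw, top_add])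
    have hmul : c * w = c * w' := (ENNReal.add_left_inj hr).1 (hw.trans hw'.symm)
    rcases eq_or_ne c ∞ with rfl | hc_top
    · have hzero {u : ℝ≥0∞} (hu : ∞ * u ≠ ∞) : u = 0 := by_contra fun h => hu (ENNReal.top_mul h)
      rw [hzero hcw, hzero fun h => hcw (hmul.trans h)]
    · exact (ENNReal.mul_right_inj hc hc_top).1 hmul
  rcases hsub.eq_empty_or_singleton with h | ⟨x, h⟩
  · exact measure_mono_null (fun ω hω => h.subset hω) measure_empty
  · exact measure_mono_null (fun ω hω => h.subset hω) (hatom x)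

variable [Countable ι]

lemma indepFun_tsum_ite_ne [DecidableEq ι] {W : ι → Ω → ℝ≥0∞} (hW : ∀ i, Measurable (W i))
    (hindep : iIndepFun W μ) (c : ι → ℝ≥0∞) (i : ι) :
    IndepFun (fun ω => ∑' j, if j = i then 0 else c j * W j ω) (W i) μ := by
  let m (j : ι) : MeasurableSpace Ω := MeasurableSpace.comap (W j) inferInstance
  have hm : Indep (⨆ j ∈ ({i}ᶜ : Set ι), m j) (⨆ j ∈ ({i} : Set ι), m j) μ :=
    indep_iSup_of_disjoint (fun j => (hW j).comap_le) hindep disjoint_compl_left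
  have hrest : Measurable[⨆ j ∈ ({i}ᶜ : Set ι), m j]
      fun ω => ∑' j, if j = i then 0 else c j * W j ω :=
    measurable_tsum_ite_ne
      (fun j hj => (comap_measurable (W j)).mono (le_iSup₂_of_le j hj le_rfl) le_rfl) c
  rw [IndepFun_iff_Indep]
  exact indep_of_indep_of_le_left
    (indep_of_indep_of_le_right hm (le_iSup₂_of_le i rfl le_rfl)) hrest.comap_le

lemma measure_tsum_const_mul_eq_zero [IsProbabilityMeasure μ] {W : ι → Ω → ℝ≥0∞}
    (hW : ∀ i, Measurable (W i)) (hindep : iIndepFun W μ)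
    (hatom : ∀ i x, μ {ω | W i ω = x} = 0) (c : ι → ℝ≥0∞) {t : ℝ≥0∞} (ht₀ : t ≠ 0) (ht : t ≠ ∞) :
    μ {ω | ∑' i, c i * W i ω = t} = 0 := by
  classical
  by_cases hc : ∃ i, c i ≠ 0
  · obtain ⟨i, hi⟩ := hc
    have hsplit (ω : Ω) : ∑' j, c j * W j ω
        = c i * W i ω + ∑' j, if j = i then 0 else c j * W j ω :=
      (ENNReal.tsum_eq_add_tsum_ite i).trans (by congr!)
    simp only [hsplit]
    exact measure_mul_add_eq_zero (measurable_tsum_ite_ne (fun j _ => hW j) c) (hW i)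
      (indepFun_tsum_ite_ne hW hindep c i) (hatom i) hi ht
  · push Not at hc
    simp [hc, ht₀.symm]

lemma measure_tsum_mul_eq_zero [IsProbabilityMeasure μ] {C W : ι → Ω → ℝ≥0∞}
    (hC : ∀ i, Measurable (C i)) (hW : ∀ i, Measurable (W i))
    (hCW : IndepFun (fun ω i => C i ω) (fun ω i => W i ω) μ)
    (hindep : iIndepFun W μ) (hatom : ∀ i x, μ {ω | W i ω = x} = 0) {t : ℝ≥0∞}
    (ht₀ : t ≠ 0) (ht : t ≠ ∞) : μ {ω | ∑' i, C i ω * W i ω = t} = 0 :=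
  measure_prodMk_mem_eq_zero_of_indepFun
    (A := {p : (ι → ℝ≥0∞) × (ι → ℝ≥0∞) | ∑' i, p.1 i * p.2 i = t})
    (measurable_pi_iff.2 hC) (measurable_pi_iff.2 hW) hCW
    ((Measurable.tsum fun i => by fun_prop) (measurableSet_singleton t))
    fun c => measure_tsum_const_mul_eq_zero hW hindep hatom c ht₀ ht

end NoAtoms

section Gamma

variable {a r : ℝ}

lemma lintegral_exp_neg_gammaMeasure (ha : 0 < a) (hr : 0 < r) {c : ℝ} (hc : 0 ≤ c) :
    ∫⁻ x, ENNReal.ofReal (Real.exp (-(c * x))) ∂(gammaMeasure a r)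
      = ENNReal.ofReal ((r / (r + c)) ^ a) := by
  have hrc : 0 < r + c := by linarith
  have hdensity (x : ℝ) : gammaPDF a r x * ENNReal.ofReal (Real.exp (-(c * x)))
      = ENNReal.ofReal ((r / (r + c)) ^ a) * gammaPDF a (r + c) x := by
    rcases lt_or_ge x 0 with hx | hx
    · simp [gammaPDF_of_neg hx]
    · rw [gammaPDF_of_nonneg hx, gammaPDF_of_nonneg hx, ← ENNReal.ofReal_mul (by positivity),
        ← ENNReal.ofReal_mul (by positivity), Real.div_rpow hr.le hrc.le,
        show -((r + c) * x) = -(r * x) + -(c * x) by ring, Real.exp_add]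
      have := (Real.rpow_pos_of_pos hrc a).ne'
      congr 1
      field_simp
  have hm : Measurable (gammaPDF a r) := (measurable_gammaPDFReal a r).ennreal_ofReal
  rw [gammaMeasure, lintegral_withDensity_eq_lintegral_mul _ hm (by fun_prop)]
  simp only [Pi.mul_apply, hdensity]
  rw [lintegral_const_mul' _ _ ENNReal.ofReal_ne_top, lintegral_gammaPDF_eq_one ha hrc, mul_one]

lemma gammaMeasure_singleton (a r x : ℝ) : gammaMeasure a r {x} = 0 :=
  withDensity_absolutelyContinuous _ _ (measure_singleton x)

lemma ae_pos_gammaMeasure (a r : ℝ) : ∀ᵐ x ∂(gammaMeasure a r), 0 < x := by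
  have hIic : gammaMeasure a r (Iic 0) = 0 := by
    rw [gammaMeasure, withDensity_apply _ measurableSet_Iic,
      setLIntegral_congr Iio_ae_eq_Iic.symm, lintegral_gammaPDF_of_nonpos le_rfl]
  filter_upwards [measure_eq_zero_iff_ae_notMem.1 hIic] with x hx using not_le.1 hx

end Gamma

section Lerch

open scoped BoundedContinuousFunction

variable {E : Type*} [TopologicalSpace E] [PolishSpace E] [MeasurableSpace E] [BorelSpace E]

lemma ext_of_integral_pow_of_injective {P Q : Measure E} [IsFiniteMeasure P] [IsFiniteMeasure Q]
    {b : E →ᵇ ℝ} (hb : Function.Injective b) (h : ∀ n : ℕ, ∫ t, b t ^ n ∂P = ∫ t, b t ^ n ∂Q) :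
    P = Q := by
  -- By Stone-Weierstrass it suffices to integrate the polynomials in `b`, which separate points.
  let A : StarSubalgebra ℝ (E →ᵇ ℝ) :=
    { Algebra.adjoin ℝ {b} with
      star_mem' := fun {f} hf => by
        have hstar : star f = f := by ext; simp
        rwa [hstar] }
  refine ext_of_forall_mem_subalgebra_integral_eq_of_polish (A := A) (fun x y hxy => ?_) ?_
  · exact ⟨b, ⟨b.toContinuousMap, ⟨b, Algebra.subset_adjoin (mem_singleton _), rfl⟩, rfl⟩,
      hb.ne hxy⟩
  · suffices hpoly : ∀ p : Polynomial ℝ,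
        ∫ t, (Polynomial.aeval b p) t ∂P = ∫ t, (Polynomial.aeval b p) t ∂Q by
      intro g (hg : g ∈ Algebra.adjoin ℝ {b})
      rw [Algebra.adjoin_singleton_eq_range_aeval] at hg
      obtain ⟨p, rfl⟩ := hg
      exact hpoly p
    intro p
    induction p using Polynomial.induction_on' with
    | add p q hp hq =>
      simp only [map_add, BoundedContinuousFunction.coe_add, Pi.add_apply]
      rw [integral_add (BoundedContinuousFunction.integrable _ _)
          (BoundedContinuousFunction.integrable _ _),
        integral_add (BoundedContinuousFunction.integrable _ _)
          (BoundedContinuousFunction.integrable _ _), hp, hq]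
    | monomial n a =>
      have hmonomial (t : E) : Polynomial.aeval b (Polynomial.monomial n a) t = a * b t ^ n := by
        simp [Polynomial.aeval_monomial, Algebra.algebraMap_eq_smul_one]
      simp only [hmonomial, integral_const_mul, h n]

lemma ae_eq_zero_of_integral_pow_mul {m : Measure E} {b : E →ᵇ ℝ} (hb : Function.Injective b)
    {u : E → ℝ} (hu : Integrable u m) (h : ∀ n : ℕ, ∫ t, b t ^ n * u t ∂m = 0) :
    u =ᵐ[m] 0 := by
  have hu' : AEMeasurable (fun t => ENNReal.ofReal (u t)) m := hu.aemeasurable.ennreal_ofReal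
  have hu'' : AEMeasurable (fun t => ENNReal.ofReal (-u t)) m :=
    hu.neg.aemeasurable.ennreal_ofReal
  have hfin : ∫⁻ t, ENNReal.ofReal (u t) ∂m ≠ ∞ := hu.lintegral_lt_top.ne
  have := isFiniteMeasure_withDensity hfin
  have := isFiniteMeasure_withDensity (f := fun t => ENNReal.ofReal (-u t))
    hu.neg.lintegral_lt_top.ne
  have hparts : m.withDensity (fun t => ENNReal.ofReal (u t))
      = m.withDensity (fun t => ENNReal.ofReal (-u t)) := by
    refine ext_of_integral_pow_of_injective hb fun n => ?_
    have hinteg {v : E → ℝ} (hv : Integrable v m) :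
        Integrable (fun t => (ENNReal.ofReal (v t)).toReal • b t ^ n) m := by
      simp only [ENNReal.toReal_ofReal', smul_eq_mul]
      exact hv.pos_part.mul_bdd (b.continuous.pow n).aestronglyMeasurable
        (Eventually.of_forall fun t => (b ^ n).norm_coe_le_norm t)
    rw [integral_withDensity_eq_integral_toReal_smul₀ hu' (by simp),
      integral_withDensity_eq_integral_toReal_smul₀ hu'' (by simp), ← sub_eq_zero,
      ← integral_sub (hinteg hu) (hinteg (v := fun t => -u t) hu.neg), ← h n]
    congr 1 with t
    rw [← sub_smul, ENNReal.toReal_ofReal', ENNReal.toReal_ofReal',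
      max_zero_sub_max_neg_zero_eq_self, smul_eq_mul, mul_comm]
  filter_upwards [(withDensity_eq_iff hu' hu'' hfin).1 hparts] with t ht
  have hmax : max (u t) 0 = max (-u t) 0 := by
    simpa only [ENNReal.toReal_ofReal'] using congrArg ENNReal.toReal ht
  have := max_zero_sub_max_neg_zero_eq_self (u t)
  rw [Pi.zero_apply]
  linarith

lemma ae_eq_zero_of_integral_exp_neg_nat_mul {u : ℝ → ℝ} (hu : IntegrableOn u (Ioi 0))
    (h : ∀ n : ℕ, ∫ t in Ioi (0 : ℝ), Real.exp (-(n * t)) * u t = 0) :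
    u =ᵐ[volume.restrict (Ioi 0)] 0 := by
  have : PolishSpace (Ioi (0 : ℝ)) := isOpen_Ioi.polishSpace
  let b : Ioi (0 : ℝ) →ᵇ ℝ := .ofNormedAddCommGroup (fun t => Real.exp (-t)) (by fun_prop) 1
    fun t => by simpa using t.2.le
  have hb : Function.Injective b := fun x y hxy =>
    Subtype.ext (neg_injective (Real.exp_injective hxy))
  have hzero : (fun t : Ioi (0 : ℝ) => u t) =ᵐ[volume.comap Subtype.val] 0 := by
    refine ae_eq_zero_of_integral_pow_mul hb
      ((integrableOn_iff_comap_subtypeVal measurableSet_Ioi).1 hu) fun n => ?_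
    refine Eq.trans ?_ (h n)
    rw [← integral_subtype_comap measurableSet_Ioi]
    refine integral_congr_ae (Eventually.of_forall fun t => ?_)
    change Real.exp (-t) ^ n * u t = Real.exp (-(n * t)) * u t
    rw [← Real.exp_nat_mul, mul_neg]
  exact (ae_restrict_iff_subtype measurableSet_Ioi).2 hzero

theorem IsInverseLaplace.eqOn {g f₁ f₂ : ℝ → ℝ} (h₁ : IsInverseLaplace g f₁)
    (h₂ : IsInverseLaplace g f₂) : EqOn f₁ f₂ (Ioi 0) := by
  have hinteg : ∀ s > 0, IntegrableOn (fun t => Real.exp (-s * t) * (f₁ t - f₂ t)) (Ioi 0) ∧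
      ∫ t in Ioi (0 : ℝ), Real.exp (-s * t) * (f₁ t - f₂ t) = 0 := by
    intro s hs
    obtain ⟨hinteg₁, heq₁⟩ := h₁.2 s hs
    obtain ⟨hinteg₂, heq₂⟩ := h₂.2 s hs
    simp only [mul_sub]
    exact ⟨hinteg₁.sub hinteg₂, by rw [integral_sub hinteg₁ hinteg₂, heq₁, heq₂, sub_self]⟩
  have hzero : ∀ᵐ t ∂(volume.restrict (Ioi (0 : ℝ))), Real.exp (-1 * t) * (f₁ t - f₂ t) = 0 := by
    refine ae_eq_zero_of_integral_exp_neg_nat_mul (hinteg 1 one_pos).1 fun n => ?_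
    refine Eq.trans ?_ (hinteg (n + 1) (by positivity)).2
    congr 1 with t
    rw [← mul_assoc, ← Real.exp_add]
    ring_nf
  refine Measure.eqOn_open_of_ae_eq (μ := volume) ?_ isOpen_Ioi h₁.1 h₂.1
  filter_upwards [hzero] with t ht
  exact sub_eq_zero.1 ((mul_eq_zero.1 ht).resolve_left (Real.exp_pos _).ne')

lemma IsInverseLaplace.isInverseLaplace_inverseLaplace {g f : ℝ → ℝ}
    (h : IsInverseLaplace g f) : IsInverseLaplace g (inverseLaplace g) := by
  have hex : ∃ f, IsInverseLaplace g f := ⟨f, h⟩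
  rw [inverseLaplace, dif_pos hex]
  exact hex.choose_spec

lemma IsInverseLaplace.congr {g g' f : ℝ → ℝ} (h : IsInverseLaplace g f)
    (hg : EqOn g g' (Ioi 0)) : IsInverseLaplace g' f :=
  ⟨h.1, fun s hs => ⟨(h.2 s hs).1, (h.2 s hs).2.trans (hg hs)⟩⟩

end Lerch

section DistributionFunction

lemma continuousAt_cdf {ρ : Measure ℝ} [IsProbabilityMeasure ρ] {t : ℝ} (ht : ρ {t} = 0) :
    ContinuousAt (cdf ρ) t := by
  rw [← measure_cdf ρ, StieltjesFunction.measure_singleton, ENNReal.ofReal_eq_zero,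
    sub_nonpos] at ht
  rw [(monotone_cdf ρ).continuousAt_iff_leftLim_eq_rightLim, StieltjesFunction.rightLim_eq]
  exact le_antisymm ((monotone_cdf ρ).leftLim_le le_rfl) ht

lemma setLIntegral_Ioi_indicator_Ici_exp_neg {s x : ℝ} (hs : 0 < s) (hx : 0 ≤ x) :
    ∫⁻ t in Ioi (0 : ℝ), (Ici x).indicator (fun t => ENNReal.ofReal (Real.exp (-s * t))) t
      = ENNReal.ofReal (1 / s) * ENNReal.ofReal (Real.exp (-(s * x))) := by
  have hset : (Ici x ∩ Ioi (0 : ℝ) : Set ℝ) =ᵐ[volume] Ioi x := by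
    simpa only [inter_eq_left.2 (Ioi_subset_Ioi hx)] using
      (Ioi_ae_eq_Ici (a := x)).symm.inter (ae_eq_refl (Ioi (0 : ℝ)))
  rw [lintegral_indicator measurableSet_Ici, Measure.restrict_restrict measurableSet_Ici,
    setLIntegral_congr hset, ← ofReal_integral_eq_lintegral_ofReal
      (integrableOn_exp_mul_Ioi (neg_neg_of_pos hs) x)
      (Eventually.of_forall fun t => (Real.exp_pos _).le),
    integral_exp_mul_Ioi (neg_neg_of_pos hs), ← ENNReal.ofReal_mul (by positivity), neg_mul]
  congr 1
  field_simp

lemma lintegral_exp_neg_mul_cdf {ρ : Measure ℝ} [IsProbabilityMeasure ρ]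
    (hρ : ∀ᵐ x ∂ρ, 0 ≤ x) {s : ℝ} (hs : 0 < s) :
    ∫⁻ t in Ioi (0 : ℝ), ENNReal.ofReal (Real.exp (-s * t) * cdf ρ t)
      = ENNReal.ofReal (1 / s) * ∫⁻ x, ENNReal.ofReal (Real.exp (-(s * x))) ∂ρ := by
  have hmeas : Measurable fun p : ℝ × ℝ =>
      (Ici p.2).indicator (fun t => ENNReal.ofReal (Real.exp (-s * t))) p.1 :=
    Measurable.indicator (f := fun p : ℝ × ℝ => ENNReal.ofReal (Real.exp (-s * p.1)))
      (by fun_prop) (measurableSet_le measurable_snd measurable_fst)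
  have hcdf (t : ℝ) : ENNReal.ofReal (Real.exp (-s * t) * cdf ρ t)
      = ∫⁻ x, (Ici x).indicator (fun t => ENNReal.ofReal (Real.exp (-s * t))) t ∂ρ := by
    have hswap (x : ℝ) : (Ici x).indicator (fun t => ENNReal.ofReal (Real.exp (-s * t))) t
        = (Iic t).indicator (fun _ => ENNReal.ofReal (Real.exp (-s * t))) x := by
      simp [indicator]
    simp only [hswap]
    rw [lintegral_indicator_const measurableSet_Iic, ENNReal.ofReal_mul (Real.exp_pos _).le,
      ofReal_cdf]
  simp only [hcdf]
  rw [lintegral_lintegral_swap hmeas.aemeasurable,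
    ← lintegral_const_mul' _ _ ENNReal.ofReal_ne_top]
  refine lintegral_congr_ae ?_
  filter_upwards [hρ] with x hx using setLIntegral_Ioi_indicator_Ici_exp_neg hs hx

lemma isInverseLaplace_cdf {ρ : Measure ℝ} [IsProbabilityMeasure ρ] (hρ : ∀ᵐ x ∂ρ, 0 ≤ x)
    (hatom : ∀ t > 0, ρ {t} = 0) :
    IsInverseLaplace (fun s => 1 / s * ∫ x, Real.exp (-(s * x)) ∂ρ) (cdf ρ) := by
  refine ⟨fun t ht => (continuousAt_cdf (hatom t ht)).continuousWithinAt, fun s hs => ?_⟩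
  have hinteg : IntegrableOn (fun t => Real.exp (-s * t) * cdf ρ t) (Ioi 0) := by
    refine (integrableOn_exp_mul_Ioi (neg_neg_of_pos hs) 0).mul_bdd (c := 1)
      (monotone_cdf ρ).measurable.aestronglyMeasurable (Eventually.of_forall fun t => ?_)
    rw [Real.norm_of_nonneg (cdf_nonneg ρ t)]
    exact cdf_le_one ρ t
  refine ⟨hinteg, ?_⟩
  beta_reduce
  rw [integral_eq_lintegral_of_nonneg_ae
      (Eventually.of_forall fun t => mul_nonneg (Real.exp_pos _).le (cdf_nonneg ρ t))
      hinteg.aestronglyMeasurable,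
    integral_eq_lintegral_of_nonneg_ae (μ := ρ)
      (Eventually.of_forall fun x => (Real.exp_pos _).le) (by fun_prop),
    lintegral_exp_neg_mul_cdf hρ hs, ENNReal.toReal_mul, ENNReal.toReal_ofReal (by positivity)]

lemma measureReal_le_eq_one_sub_cdf {Ω : Type*} [MeasurableSpace Ω] {μ : Measure Ω}
    [IsProbabilityMeasure μ] {Z : Ω → ℝ} (hZ : Measurable Z) {t : ℝ}
    (ht : μ {ω | Z ω = t} = 0) : μ.real {ω | t ≤ Z ω} = 1 - cdf (μ.map Z) t := by
  have := Measure.isProbabilityMeasure_map (μ := μ) hZ.aemeasurable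
  have hne : ∀ᵐ ω ∂μ, Z ω ≠ t := by simpa [ae_iff] using ht
  have hset : {ω | t ≤ Z ω} =ᵐ[μ] ((Z ⁻¹' Iic t)ᶜ : Set Ω) := by
    filter_upwards [hne] with ω hω
    exact propext ⟨fun h => not_le.2 (h.lt_of_ne' hω), fun (h : ¬Z ω ≤ t) => (not_le.1 h).le⟩
  rw [cdf_eq_real, map_measureReal_apply hZ measurableSet_Iic, measureReal_congr hset,
    probReal_compl_eq_one_sub (hZ measurableSet_Iic)]

end DistributionFunction

section ExpNeg

lemma ae_mem_of_tendsto_lintegral_one {Ω : Type*} [MeasurableSpace Ω] {μ : Measure Ω}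
    [IsProbabilityMeasure μ] {ι : Type*} {l : Filter ι} [l.NeBot]
    {f : ι → Ω → ℝ≥0∞} {A : Set Ω} (hA : MeasurableSet A)
    (hle : ∀ᶠ s in l, ∀ᵐ ω ∂μ, f s ω ≤ A.indicator 1 ω)
    (hlim : Tendsto (fun s => ∫⁻ ω, f s ω ∂μ) l (𝓝 1)) : ∀ᵐ ω ∂μ, ω ∈ A := by
  refine (prob_compl_eq_zero_iff hA).2 (le_antisymm prob_le_one (le_of_tendsto hlim ?_))
  filter_upwards [hle] with s hs
  rw [← lintegral_indicator_one hA]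
  exact lintegral_mono_ae hs

variable {ι : Type*} {y : ι → ℝ}

lemma finsetProd_ofReal_exp_neg (y : ι → ℝ) (s : Finset ι) :
    ∏ i ∈ s, ENNReal.ofReal (Real.exp (-y i)) = ENNReal.ofReal (Real.exp (-∑ i ∈ s, y i)) := by
  rw [← ENNReal.ofReal_prod_of_nonneg (fun _ _ => (Real.exp_pos _).le), ← Real.exp_sum,
    Finset.sum_neg_distrib]

lemma tprod_ofReal_exp_neg (h : Summable y) :
    ∏' i, ENNReal.ofReal (Real.exp (-y i)) = ENNReal.ofReal (Real.exp (-∑' i, y i)) := by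
  refine HasProd.tprod_eq ?_
  simp only [HasProd, finsetProd_ofReal_exp_neg]
  exact ((ENNReal.continuous_ofReal.comp Real.continuous_exp).comp continuous_neg).tendsto _
    |>.comp h.hasSum

lemma summable_of_tprod_ofReal_exp_neg_ne_zero (hy : ∀ i, 0 ≤ y i)
    (h : ∏' i, ENNReal.ofReal (Real.exp (-y i)) ≠ 0) : Summable y := by
  have hle (i : ι) : ENNReal.ofReal (Real.exp (-y i)) ≤ 1 :=
    ENNReal.ofReal_le_one.2 (Real.exp_le_one_iff.2 (neg_nonpos.2 (hy i)))
  set p := (∏' i, ENNReal.ofReal (Real.exp (-y i))).toReal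
  have hp : 0 < p :=
    ENNReal.toReal_pos h (ne_top_of_le_ne_top ENNReal.one_ne_top (tprod_le_one hle))
  refine summable_of_sum_le (c := -Real.log p) hy fun s => ?_
  have hps : p ≤ Real.exp (-∑ i ∈ s, y i) := by
    refine ENNReal.toReal_le_of_le_ofReal (Real.exp_pos _).le ?_
    rw [← finsetProd_ofReal_exp_neg, ENNReal.tprod_eq_iInf_prod hle]
    exact iInf_le _ s
  have := (Real.log_le_log hp hps).trans_eq (Real.log_exp _)
  linarith

lemma ae_summable_of_tendsto_lintegral_tprod_exp_neg [Countable ι] {Ω : Type*}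
    [MeasurableSpace Ω] {μ : Measure Ω} [IsProbabilityMeasure μ] {y : ι → Ω → ℝ}
    (hy : ∀ i, Measurable (y i)) (hy₀ : ∀ᵐ ω ∂μ, ∀ i, 0 ≤ y i ω)
    (hlim : Tendsto (fun s => ∫⁻ ω, ∏' i, ENNReal.ofReal (Real.exp (-(s * y i ω))) ∂μ)
      (𝓝[>] 0) (𝓝 1)) : ∀ᵐ ω ∂μ, Summable fun i => y i ω := by
  have hA : MeasurableSet {ω | ∑' i, ENNReal.ofReal (y i ω) ≠ ∞} :=
    (Measurable.tsum fun i => (hy i).ennreal_ofReal) (measurableSet_singleton ∞).compl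
  have hfin : ∀ᵐ ω ∂μ, ω ∈ {ω | ∑' i, ENNReal.ofReal (y i ω) ≠ ∞} := by
    refine ae_mem_of_tendsto_lintegral_one hA ?_ hlim
    filter_upwards [self_mem_nhdsWithin] with s (hs : 0 < s)
    filter_upwards [hy₀] with ω hω
    have hsy (i : ι) : 0 ≤ s * y i ω := mul_nonneg hs.le (hω i)
    by_cases hprod : ∏' i, ENNReal.ofReal (Real.exp (-(s * y i ω))) = 0
    · exact hprod.trans_le zero_le
    · have hsum : Summable fun i => y i ω :=
        (summable_mul_left_iff hs.ne').1 (summable_of_tprod_ofReal_exp_neg_ne_zero hsy hprod)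
      rw [indicator_of_mem (s := {ω | ∑' i, ENNReal.ofReal (y i ω) ≠ ∞}) hsum.tsum_ofReal_ne_top]
      exact tprod_le_one fun i =>
        ENNReal.ofReal_le_one.2 (Real.exp_le_one_iff.2 (neg_nonpos.2 (hsy i)))
  filter_upwards [hfin, hy₀] with ω hω hω₀
  simpa only [ENNReal.toReal_ofReal (hω₀ _)] using ENNReal.summable_toReal hω

end ExpNeg

section LinkTransform

/-- The Laplace transform at `a` of a gamma variable of shape `N` and mean `1`. -/
noncomputable def gammaTransform (N : ℕ) (a : ℝ) : ℝ := (1 + a / N) ^ (-(N : ℤ))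

lemma gammaTransform_eq_inv (N : ℕ) (a : ℝ) : gammaTransform N a = ((1 + a / N) ^ N)⁻¹ := by
  rw [gammaTransform, zpow_neg, zpow_natCast]

lemma measurable_gammaTransform (N : ℕ) : Measurable (gammaTransform N) := by
  rw [funext (gammaTransform_eq_inv N)]
  fun_prop

lemma gammaTransform_mem_Icc (N : ℕ) {a : ℝ} (ha : 0 ≤ a) : gammaTransform N a ∈ Icc 0 1 := by
  have : 0 ≤ a / N := by positivity
  rw [gammaTransform_eq_inv]
  exact ⟨by positivity, inv_le_one_of_one_le₀ (one_le_pow₀ (by linarith))⟩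

lemma one_sub_le_gammaTransform (N : ℕ) {a : ℝ} (ha : 0 ≤ a) : 1 - a ≤ gammaTransform N a := by
  have hpow : (1 + a / N) ^ N ≤ Real.exp a := by
    have := Real.one_sub_div_pow_le_exp_neg (n := N) (t := -a)
      ((neg_nonpos.2 ha).trans N.cast_nonneg)
    rwa [neg_div, sub_neg_eq_add, neg_neg] at this
  calc 1 - a ≤ Real.exp (-a) := Real.one_sub_le_exp_neg a
    _ ≤ gammaTransform N a := by
      rw [gammaTransform_eq_inv, Real.exp_neg]
      exact inv_anti₀ (by positivity) hpow

lemma tendsto_gammaTransform (a : ℝ) :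
    Tendsto (fun n => gammaTransform n a) atTop (𝓝 (Real.exp (-a))) := by
  simp only [gammaTransform_eq_inv, Real.exp_neg]
  exact (Real.tendsto_one_add_div_pow_exp a).inv₀ (Real.exp_pos a).ne'

lemma lintegral_exp_neg_mul_div_gammaMeasure {N : ℕ} (hN : 0 < N) {a : ℝ} (ha : 0 ≤ a) :
    ∫⁻ g, ENNReal.ofReal (Real.exp (-(a * (g / N)))) ∂(gammaMeasure N 1)
      = ENNReal.ofReal (gammaTransform N a) := by
  have hN' : (0 : ℝ) < N := Nat.cast_pos.2 hN
  simp only [mul_div_left_comm a, mul_comm _ (a / (N : ℝ))]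
  rw [lintegral_exp_neg_gammaMeasure hN' one_pos (by positivity), gammaTransform_eq_inv, one_div,
    Real.rpow_natCast, inv_pow]

/-- The Laplace transform at `a` of `G L`, where the gain `G` is a gamma variable of shape `N` and
mean `1` and `L` is the attenuation factor of a link at elevation angle `θ`. -/
noncomputable def linkTransform (c₁ c₂ ℓ : ℝ) (N : ℕ) (θ a : ℝ) : ℝ :=
  losProb c₁ c₂ θ * gammaTransform N a + (1 - losProb c₁ c₂ θ) * gammaTransform N (a * ℓ)

variable {c₁ c₂ ℓ : ℝ}

lemma losProb_mem_Icc (hc₂ : 0 ≤ c₂) (θ : ℝ) : losProb c₁ c₂ θ ∈ Icc 0 1 := by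
  have : 0 ≤ c₂ * Real.exp (-c₁ * θ) := by positivity
  unfold losProb
  exact ⟨by positivity, div_le_one_of_le₀ (by linarith) (by positivity)⟩

lemma measurable_losProb (c₁ c₂ : ℝ) : Measurable (losProb c₁ c₂) := by
  unfold losProb
  fun_prop

lemma measurable_linkTransform (c₁ c₂ ℓ : ℝ) (N : ℕ) :
    Measurable (Function.uncurry (linkTransform c₁ c₂ ℓ N)) := by
  have hp : Measurable fun p : ℝ × ℝ => losProb c₁ c₂ p.1 :=
    (measurable_losProb c₁ c₂).comp measurable_fst
  have hg := measurable_gammaTransform N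
  exact (hp.mul (hg.comp measurable_snd)).add
    ((hp.const_sub 1).mul (hg.comp (measurable_snd.mul_const ℓ)))

variable {N : ℕ} {a : ℝ}

lemma linkTransform_mem_of_convex (hc₂ : 0 ≤ c₂) {S : Set ℝ} (hS : Convex ℝ S)
    (hlos : gammaTransform N a ∈ S) (hnlos : gammaTransform N (a * ℓ) ∈ S) (θ : ℝ) :
    linkTransform c₁ c₂ ℓ N θ a ∈ S :=
  hS hlos hnlos (losProb_mem_Icc hc₂ θ).1 (sub_nonneg.2 (losProb_mem_Icc hc₂ θ).2)
    (add_sub_cancel _ _)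

lemma linkTransform_mem_Icc (hc₂ : 0 ≤ c₂) (hℓ : 0 ≤ ℓ) (ha : 0 ≤ a) (θ : ℝ) :
    linkTransform c₁ c₂ ℓ N θ a ∈ Icc 0 1 :=
  linkTransform_mem_of_convex hc₂ (convex_Icc 0 1) (gammaTransform_mem_Icc N ha)
    (gammaTransform_mem_Icc N (mul_nonneg ha hℓ)) θ

lemma one_sub_linkTransform_le (hc₂ : 0 ≤ c₂) (hℓ : 0 ≤ ℓ) (ha : 0 ≤ a) (θ : ℝ) :
    1 - linkTransform c₁ c₂ ℓ N θ a ≤ max 1 ℓ * a := by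
  have hlos : 1 - max 1 ℓ * a ≤ gammaTransform N a :=
    (sub_le_sub_left (le_mul_of_one_le_left ha (le_max_left 1 ℓ)) 1).trans
      (one_sub_le_gammaTransform N ha)
  have hnlos : 1 - max 1 ℓ * a ≤ gammaTransform N (a * ℓ) := by
    refine le_trans ?_ (one_sub_le_gammaTransform N (mul_nonneg ha hℓ))
    rw [mul_comm a]
    gcongr
    exact le_max_right 1 ℓ
  exact sub_le_comm.1 (linkTransform_mem_of_convex hc₂ (convex_Ici _) hlos hnlos θ)

lemma tendsto_linkTransform (c₁ c₂ ℓ θ a : ℝ) :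
    Tendsto (fun n => linkTransform c₁ c₂ ℓ n θ a) atTop
      (𝓝 (losProb c₁ c₂ θ * Real.exp (-a) + (1 - losProb c₁ c₂ θ) * Real.exp (-(a * ℓ)))) :=
  ((tendsto_gammaTransform a).const_mul _).add ((tendsto_gammaTransform (a * ℓ)).const_mul _)

end LinkTransform

section JG

variable {c₁ c₂ α ℓ x : ℝ} {N : ℕ} {ν : Measure ℝ}

lemma measurable_linkTransform_cos (c₁ c₂ α ℓ : ℝ) (N : ℕ) (x : ℝ) :
    Measurable fun y => linkTransform c₁ c₂ ℓ N y (x * Real.cos y ^ α) :=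
  (measurable_linkTransform c₁ c₂ ℓ N).comp (f := fun y : ℝ => (y, x * Real.cos y ^ α))
    (by fun_prop)

lemma ae_linkTransform_cos_mem_Icc (hc₂ : 0 ≤ c₂) (hℓ : 0 ≤ ℓ) (hx : 0 ≤ x)
    (hν : ∀ᵐ y ∂ν, 0 ≤ Real.cos y) (N : ℕ) :
    ∀ᵐ y ∂ν, linkTransform c₁ c₂ ℓ N y (x * Real.cos y ^ α) ∈ Icc 0 1 := by
  filter_upwards [hν] with y hy using linkTransform_mem_Icc hc₂ hℓ (by positivity) y

variable [IsProbabilityMeasure ν]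

lemma integrable_linkTransform_cos (hc₂ : 0 ≤ c₂) (hℓ : 0 ≤ ℓ) (hx : 0 ≤ x)
    (hν : ∀ᵐ y ∂ν, 0 ≤ Real.cos y) :
    Integrable (fun y => linkTransform c₁ c₂ ℓ N y (x * Real.cos y ^ α)) ν := by
  refine Integrable.of_bound (measurable_linkTransform_cos ..).aestronglyMeasurable 1 ?_
  filter_upwards [ae_linkTransform_cos_mem_Icc hc₂ hℓ hx hν N] with y hy
  exact (Real.norm_of_nonneg hy.1).trans_le hy.2

lemma JG_eq_integral (hc₂ : 0 ≤ c₂) (hℓ : 0 ≤ ℓ) (hx : 0 ≤ x)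
    (hν : ∀ᵐ y ∂ν, 0 ≤ Real.cos y) :
    JG c₁ c₂ α ℓ N x ν = ∫ y, 1 - linkTransform c₁ c₂ ℓ N y (x * Real.cos y ^ α) ∂ν := by
  rw [integral_sub (integrable_const 1) (integrable_linkTransform_cos hc₂ hℓ hx hν)]
  simp [JG, linkTransform, gammaTransform]

lemma JG_mem_Icc (hc₂ : 0 ≤ c₂) (hℓ : 0 ≤ ℓ) (hx : 0 ≤ x) (hν : ∀ᵐ y ∂ν, 0 ≤ Real.cos y) :
    JG c₁ c₂ α ℓ N x ν ∈ Icc 0 1 := by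
  have hlink := ae_linkTransform_cos_mem_Icc (c₁ := c₁) (α := α) hc₂ hℓ hx hν N
  refine ⟨?_, sub_le_self 1 (integral_nonneg_of_ae ?_)⟩
  · rw [JG_eq_integral hc₂ hℓ hx hν]
    exact integral_nonneg_of_ae (hlink.mono fun y hy => sub_nonneg.2 hy.2)
  · exact hlink.mono fun y hy => hy.1

lemma JG_le_mul (hc₂ : 0 ≤ c₂) (hα : 0 ≤ α) (hℓ : 0 ≤ ℓ) (hx : 0 ≤ x)
    (hν : ∀ᵐ y ∂ν, 0 ≤ Real.cos y) : JG c₁ c₂ α ℓ N x ν ≤ max 1 ℓ * x := by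
  rw [JG_eq_integral hc₂ hℓ hx hν]
  calc _ ≤ ∫ _, max 1 ℓ * x ∂ν := by
        refine integral_mono_ae ((integrable_const 1).sub
          (integrable_linkTransform_cos hc₂ hℓ hx hν)) (integrable_const _) ?_
        filter_upwards [hν] with y hy
        have hcos : Real.cos y ^ α ≤ 1 := Real.rpow_le_one hy (Real.cos_le_one y) hα
        exact (one_sub_linkTransform_le hc₂ hℓ (by positivity) y).trans
          (mul_le_mul_of_nonneg_left (mul_le_of_le_one_right hx hcos) (by positivity))
    _ = max 1 ℓ * x := by simp

lemma tendsto_JG (hc₂ : 0 ≤ c₂) (hℓ : 0 ≤ ℓ) (hx : 0 ≤ x) (hν : ∀ᵐ y ∂ν, 0 ≤ Real.cos y) :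
    Tendsto (fun n : ℕ => JG c₁ c₂ α ℓ n x ν) atTop
      (𝓝 (1 - ∫ y, (losProb c₁ c₂ y * Real.exp (-(x * Real.cos y ^ α))
        + (1 - losProb c₁ c₂ y) * Real.exp (-(x * ℓ * Real.cos y ^ α))) ∂ν)) := by
  refine Tendsto.const_sub 1 (tendsto_integral_of_dominated_convergence (fun _ => 1)
    (fun n => (measurable_linkTransform_cos c₁ c₂ α ℓ n x).aestronglyMeasurable)
    (integrable_const 1) (fun n => ?_) (Eventually.of_forall fun y => ?_))
  · filter_upwards [ae_linkTransform_cos_mem_Icc hc₂ hℓ hx hν n] with y hy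
    exact (Real.norm_of_nonneg hy.1).trans_le hy.2
  · rw [mul_right_comm x ℓ]
    exact tendsto_linkTransform c₁ c₂ ℓ y (x * Real.cos y ^ α)

end JG

section PolarCoordinates

lemma integral_plane_comp_norm_sq (f : ℝ → ℝ) :
    ∫ x : Plane, f (‖x‖ ^ 2) = Real.pi * ∫ z in Ioi (0 : ℝ), f z := by
  have hball : (volume : Measure Plane).real (Metric.ball 0 1) = Real.pi := by
    rw [measureReal_def, EuclideanSpace.volume_ball_fin_two]
    simp [Real.pi_pos.le]
  rw [integral_fun_norm_addHaar volume (f := fun r => f (r ^ 2)),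
    ← integral_comp_rpow_Ioi_of_pos (g := f) two_pos, hball, finrank_euclideanSpace_fin,
    nsmul_eq_mul, smul_eq_mul, mul_left_comm, ← integral_const_mul]
  congr 1
  refine setIntegral_congr_fun measurableSet_Ioi fun y _ => ?_
  simp only [smul_eq_mul, Real.rpow_two]
  norm_num
  ring

lemma integrable_plane_comp_norm_sq {f : ℝ → ℝ} (hf : IntegrableOn f (Ioi 0)) :
    Integrable fun x : Plane => f (‖x‖ ^ 2) := by
  rw [integrable_fun_norm_addHaar volume (f := fun r => f (r ^ 2))]
  have hpow := (integrableOn_Ioi_comp_rpow_iff f (two_ne_zero (α := ℝ))).2 hf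
  refine IntegrableOn.congr_fun (hpow.const_mul (1 / 2)) (fun y _ => ?_) measurableSet_Ioi
  simp only [smul_eq_mul, finrank_euclideanSpace_fin, Real.rpow_two]
  norm_num
  ring

end PolarCoordinates

section AngleLaw

lemma integrableOn_min_one_const_mul_rpow {r : ℝ} (hr : 1 < r) {C : ℝ} (hC : 0 ≤ C) :
    IntegrableOn (fun z : ℝ => min 1 (C * z ^ (-r))) (Ioi 0) := by
  have hmeas : Measurable fun z : ℝ => min 1 (C * z ^ (-r)) := by fun_prop
  have hnorm {z : ℝ} (hz : 0 < z) :
      ‖min 1 (C * z ^ (-r))‖ = min 1 (C * z ^ (-r)) :=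
    Real.norm_of_nonneg (by positivity)
  rw [← Ioc_union_Ioi_eq_Ioi zero_le_one]
  refine IntegrableOn.union (Integrable.mono' (integrable_const 1) hmeas.aestronglyMeasurable ?_)
    (Integrable.mono' ((integrableOn_Ioi_rpow_of_lt (a := -r) (by linarith)
      one_pos).const_mul C) hmeas.aestronglyMeasurable ?_)
  · exact ae_restrict_of_forall_mem measurableSet_Ioc fun z hz =>
      (hnorm hz.1).trans_le (min_le_left _ _)
  · exact ae_restrict_of_forall_mem measurableSet_Ioi fun z (hz : 1 < z) =>
      (hnorm (by linarith)).trans_le (min_le_right _ _)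

variable {c₁ c₂ α ℓ s : ℝ} {N : ℕ} {η : Measure ℝ}

lemma measurable_arctan_div_sqrt : Measurable fun p : ℝ × ℝ => Real.arctan (p.2 / √p.1) :=
  Real.measurable_arctan.comp (by fun_prop)

lemma isProbabilityMeasure_angleLaw [IsProbabilityMeasure η] (z : ℝ) :
    IsProbabilityMeasure (angleLaw η z) :=
  Measure.isProbabilityMeasure_map
    (measurable_arctan_div_sqrt.comp measurable_prodMk_left).aemeasurable

lemma ae_cos_nonneg_angleLaw (η : Measure ℝ) (z : ℝ) : ∀ᵐ y ∂(angleLaw η z), 0 ≤ Real.cos y :=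
  (ae_map_iff (measurable_arctan_div_sqrt.comp measurable_prodMk_left).aemeasurable
    (measurableSet_le measurable_const Real.measurable_cos)).2
    (Eventually.of_forall fun _ => (Real.cos_arctan_pos _).le)

lemma JG_angleLaw (c₁ c₂ α ℓ : ℝ) (N : ℕ) (η : Measure ℝ) (x z : ℝ) :
    JG c₁ c₂ α ℓ N x (angleLaw η z) = 1 - ∫ h, linkTransform c₁ c₂ ℓ N (Real.arctan (h / √z))
      (x * Real.cos (Real.arctan (h / √z)) ^ α) ∂η := by
  rw [← integral_map (φ := fun h => Real.arctan (h / √z))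
    (f := fun y => linkTransform c₁ c₂ ℓ N y (x * Real.cos y ^ α))
    (measurable_arctan_div_sqrt.comp measurable_prodMk_left).aemeasurable
    (measurable_linkTransform_cos ..).aestronglyMeasurable]
  rfl

lemma measurable_JG_angleLaw (c₁ c₂ α ℓ : ℝ) (N : ℕ) (η : Measure ℝ) [SFinite η] (s : ℝ) :
    Measurable fun z => JG c₁ c₂ α ℓ N (s * z ^ (-(α / 2))) (angleLaw η z) := by
  simp only [JG_angleLaw]
  have ha : Measurable fun p : ℝ × ℝ =>
      s * p.1 ^ (-(α / 2)) * Real.cos (Real.arctan (p.2 / √p.1)) ^ α :=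
    ((measurable_fst.pow_const _).const_mul s).mul (measurable_arctan_div_sqrt.cos.pow_const α)
  have hlink := (measurable_linkTransform c₁ c₂ ℓ N).comp (measurable_arctan_div_sqrt.prodMk ha)
  exact hlink.stronglyMeasurable.integral_prod_right'.measurable.const_sub 1

variable [IsProbabilityMeasure η]

lemma JG_angleLaw_nonneg (hc₂ : 0 ≤ c₂) (hℓ : 0 ≤ ℓ) (hs : 0 ≤ s) {z : ℝ} (hz : 0 ≤ z) :
    0 ≤ JG c₁ c₂ α ℓ N (s * z ^ (-(α / 2))) (angleLaw η z) := by
  have := isProbabilityMeasure_angleLaw (η := η) z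
  exact (JG_mem_Icc hc₂ hℓ (by positivity) (ae_cos_nonneg_angleLaw η z)).1

lemma norm_JG_angleLaw_le (hc₂ : 0 ≤ c₂) (hα : 0 ≤ α) (hℓ : 0 ≤ ℓ) (hs : 0 ≤ s) {z : ℝ}
    (hz : 0 ≤ z) : ‖JG c₁ c₂ α ℓ N (s * z ^ (-(α / 2))) (angleLaw η z)‖
      ≤ min 1 (max 1 ℓ * s * z ^ (-(α / 2))) := by
  have := isProbabilityMeasure_angleLaw (η := η) z
  have hcos := ae_cos_nonneg_angleLaw η z
  have hx : 0 ≤ s * z ^ (-(α / 2)) := by positivity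
  rw [Real.norm_of_nonneg (JG_angleLaw_nonneg hc₂ hℓ hs hz), mul_assoc]
  exact le_min (JG_mem_Icc hc₂ hℓ hx hcos).2 (JG_le_mul hc₂ hα hℓ hx hcos)

lemma integrableOn_JG_angleLaw (hc₂ : 0 ≤ c₂) (hα : 2 < α) (hℓ : 0 ≤ ℓ) (hs : 0 ≤ s) :
    IntegrableOn (fun z => JG c₁ c₂ α ℓ N (s * z ^ (-(α / 2))) (angleLaw η z)) (Ioi 0) := by
  refine Integrable.mono' (integrableOn_min_one_const_mul_rpow
    (r := α / 2) (by linarith) (C := max 1 ℓ * s) (by positivity))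
    (measurable_JG_angleLaw ..).aestronglyMeasurable ?_
  exact ae_restrict_of_forall_mem measurableSet_Ioi fun z (hz : 0 < z) =>
    norm_JG_angleLaw_le hc₂ (by linarith) hℓ hs hz.le

lemma tendsto_integral_JG_angleLaw (hc₂ : 0 ≤ c₂) (hα : 2 < α) (hℓ : 0 ≤ ℓ) :
    Tendsto (fun s => ∫ z in Ioi (0 : ℝ), JG c₁ c₂ α ℓ N (s * z ^ (-(α / 2))) (angleLaw η z))
      (𝓝[>] 0) (𝓝 0) := by
  suffices h : Tendsto (fun s => ∫ z in Ioi (0 : ℝ),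
      JG c₁ c₂ α ℓ N (s * z ^ (-(α / 2))) (angleLaw η z)) (𝓝[>] 0)
      (𝓝 (∫ _ in Ioi (0 : ℝ), (0 : ℝ))) by simpa only [integral_zero] using h
  refine tendsto_integral_filter_of_dominated_convergence
    (fun z => min 1 (max 1 ℓ * z ^ (-(α / 2))))
    (Eventually.of_forall fun s => (measurable_JG_angleLaw c₁ c₂ α ℓ N η s).aestronglyMeasurable) ?_
    (integrableOn_min_one_const_mul_rpow (by linarith) (by positivity)) ?_
  · filter_upwards [Ioc_mem_nhdsGT (zero_lt_one (α := ℝ))] with s hs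
    refine ae_restrict_of_forall_mem measurableSet_Ioi fun z (hz : 0 < z) =>
      (norm_JG_angleLaw_le hc₂ (by linarith) hℓ hs.1.le hz.le).trans ?_
    gcongr
    exact mul_le_of_le_one_right (by positivity) hs.2
  · refine ae_restrict_of_forall_mem measurableSet_Ioi fun z (hz : 0 < z) => ?_
    have hlim : Tendsto (fun s => max 1 ℓ * s * z ^ (-(α / 2))) (𝓝[>] 0) (𝓝 0) := by
      refine tendsto_nhdsWithin_of_tendsto_nhds (Continuous.tendsto' (by fun_prop) _ _ ?_)
      simp
    refine squeeze_zero_norm' ?_ hlim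
    filter_upwards [self_mem_nhdsWithin] with s (hs : 0 < s)
    exact (norm_JG_angleLaw_le hc₂ (by linarith) hℓ hs.le hz.le).trans (min_le_right _ _)

end AngleLaw

section NodeTransform

variable {c₁ c₂ α ℓ s lam : ℝ} {N : ℕ} {η : Measure ℝ}

lemma norm_position {x : Plane} (hx : x ≠ 0) (h : ℝ) :
    ‖position x h‖ = ‖x‖ / Real.cos (elevation x h) := by
  have : 0 < ‖x‖ := norm_pos_iff.2 hx
  rw [position, WithLp.prod_norm_eq_of_L2, elevation, Real.cos_arctan, div_div_eq_mul_div, div_one,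
    Real.sqrt_eq_iff_mul_self_eq (by positivity) (by positivity), mul_mul_mul_comm,
    Real.mul_self_sqrt (by positivity), Real.norm_eq_abs, sq_abs]
  field_simp
  rfl

lemma norm_position_rpow_neg {x : Plane} (hx : x ≠ 0) (h α : ℝ) :
    ‖position x h‖ ^ (-α) = (‖x‖ ^ 2) ^ (-(α / 2)) * Real.cos (elevation x h) ^ α := by
  have hcos : 0 < Real.cos (elevation x h) := Real.cos_arctan_pos _
  rw [norm_position hx, Real.div_rpow (norm_nonneg x) hcos.le, Real.rpow_neg hcos.le,
    div_inv_eq_mul, ← Real.rpow_natCast, ← Real.rpow_mul (norm_nonneg x)]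
  congr 2
  push_cast
  ring

lemma measurable_elevation : Measurable fun p : Plane × ℝ => elevation p.1 p.2 :=
  Real.measurable_arctan.comp (measurable_snd.div measurable_fst.norm)

lemma measurable_norm_position_rpow (r : ℝ) :
    Measurable fun p : Plane × ℝ => ‖position p.1 p.2‖ ^ r := by
  have hpos : Continuous fun p : Plane × ℝ => position p.1 p.2 :=
    WithLp.prod_continuous_toLp 2 Plane ℝ
  exact hpos.norm.measurable.pow_const r

lemma measurable_linkTransform_position (c₁ c₂ α ℓ : ℝ) (N : ℕ) (s : ℝ) :
    Measurable fun p : Plane × ℝ =>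
      linkTransform c₁ c₂ ℓ N (elevation p.1 p.2) (s * ‖position p.1 p.2‖ ^ (-α)) :=
  (measurable_linkTransform c₁ c₂ ℓ N).comp
    (f := fun p : Plane × ℝ => (elevation p.1 p.2, s * ‖position p.1 p.2‖ ^ (-α)))
    (measurable_elevation.prodMk ((measurable_norm_position_rpow (-α)).const_mul s))

/-- The Laplace transform at `s` of the power received with a gain of mean `1` from a UAV of
projection `x` whose altitude has law `η`. -/
noncomputable def nodeTransform (c₁ c₂ α ℓ : ℝ) (N : ℕ) (η : Measure ℝ) (s : ℝ) (x : Plane) :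
    ℝ≥0∞ :=
  ∫⁻ h, ENNReal.ofReal
    (linkTransform c₁ c₂ ℓ N (elevation x h) (s * ‖position x h‖ ^ (-α))) ∂η

lemma measurable_nodeTransform [SFinite η] : Measurable (nodeTransform c₁ c₂ α ℓ N η s) :=
  (measurable_linkTransform_position c₁ c₂ α ℓ N s).ennreal_ofReal.lintegral_prod_right'

variable [IsProbabilityMeasure η]

lemma nodeTransform_le_one (hc₂ : 0 ≤ c₂) (hℓ : 0 ≤ ℓ) (hs : 0 ≤ s) (x : Plane) :
    nodeTransform c₁ c₂ α ℓ N η s x ≤ 1 := by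
  refine (lintegral_mono (g := 1) fun h => ?_).trans_eq (by simp)
  exact ENNReal.ofReal_le_one.2 (linkTransform_mem_Icc hc₂ hℓ (by positivity) _).2

lemma one_sub_nodeTransform (hc₂ : 0 ≤ c₂) (hℓ : 0 ≤ ℓ) (hs : 0 ≤ s) {x : Plane} (hx : x ≠ 0) :
    1 - nodeTransform c₁ c₂ α ℓ N η s x =
      ENNReal.ofReal (JG c₁ c₂ α ℓ N (s * (‖x‖ ^ 2) ^ (-(α / 2))) (angleLaw η (‖x‖ ^ 2))) := by
  have hmem (h : ℝ) := linkTransform_mem_Icc (c₁ := c₁) (N := N)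
    (a := s * ‖position x h‖ ^ (-α)) hc₂ hℓ (by positivity) (elevation x h)
  have hinteg : Integrable (fun h => linkTransform c₁ c₂ ℓ N (elevation x h)
      (s * ‖position x h‖ ^ (-α))) η :=
    Integrable.of_bound ((measurable_linkTransform_position c₁ c₂ α ℓ N s).comp
      measurable_prodMk_left).aestronglyMeasurable 1
      (Eventually.of_forall fun h => (Real.norm_of_nonneg (hmem h).1).trans_le (hmem h).2)
  rw [nodeTransform, ← ofReal_integral_eq_lintegral_ofReal hinteg
      (Eventually.of_forall fun h => (hmem h).1), ← ENNReal.ofReal_one,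
    ← ENNReal.ofReal_sub _ (integral_nonneg fun h => (hmem h).1), JG_angleLaw,
    Real.sqrt_sq (norm_nonneg x)]
  simp only [norm_position_rpow_neg hx, mul_assoc, elevation]

lemma lintegral_one_sub_nodeTransform (hlam : 0 ≤ lam) (hc₂ : 0 ≤ c₂) (hα : 2 < α) (hℓ : 0 ≤ ℓ)
    (hs : 0 ≤ s) :
    ∫⁻ x, 1 - nodeTransform c₁ c₂ α ℓ N η s x ∂(ENNReal.ofReal lam • (volume : Measure Plane)) =
      ENNReal.ofReal (Real.pi * lam * ∫ z in Ioi (0 : ℝ),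
        JG c₁ c₂ α ℓ N (s * z ^ (-(α / 2))) (angleLaw η z)) := by
  have hJG : Integrable fun x : Plane =>
      JG c₁ c₂ α ℓ N (s * (‖x‖ ^ 2) ^ (-(α / 2))) (angleLaw η (‖x‖ ^ 2)) :=
    integrable_plane_comp_norm_sq (integrableOn_JG_angleLaw hc₂ hα hℓ hs)
  rw [lintegral_smul_measure, lintegral_congr_ae
      (((volume : Measure Plane).ae_ne 0).mono fun x hx => one_sub_nodeTransform hc₂ hℓ hs hx),
    ← ofReal_integral_eq_lintegral_ofReal hJG
      (Eventually.of_forall fun x => JG_angleLaw_nonneg hc₂ hℓ hs (sq_nonneg ‖x‖)),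
    integral_plane_comp_norm_sq fun z => JG c₁ c₂ α ℓ N (s * z ^ (-(α / 2))) (angleLaw η z),
    smul_eq_mul, ← ENNReal.ofReal_mul hlam, mul_left_comm, mul_assoc]

end NodeTransform

section ConditionalMixing

variable {ι Ω : Type*} {m mΩ : MeasurableSpace Ω} {μ : Measure Ω} [IsFiniteMeasure μ]
  {b ρ c d p q : ι → Ω → ℝ}

lemma norm_finsetProd_le_one {f : ι → ℝ} (hf : ∀ i, ‖f i‖ ≤ 1) (S : Finset ι) :
    ‖∏ i ∈ S, f i‖ ≤ 1 := by
  rw [norm_prod]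
  exact Finset.prod_le_one (fun _ _ => norm_nonneg _) fun i _ => hf i

lemma integrable_finsetProd_of_norm_le_one (hb : ∀ i, Measurable (b i))
    (hb₁ : ∀ i ω, ‖b i ω‖ ≤ 1) (S : Finset ι) : Integrable (fun ω => ∏ i ∈ S, b i ω) μ :=
  Integrable.of_bound (Finset.measurable_fun_prod _ fun i _ => hb i).aestronglyMeasurable 1
    (Eventually.of_forall fun ω => norm_finsetProd_le_one (hb₁ · ω) S)

lemma condExp_finsetProd_mul_add (hm : m ≤ mΩ) (hb : ∀ i, Measurable (b i))
    (hb₁ : ∀ i ω, ‖b i ω‖ ≤ 1) (hc : ∀ i, Measurable[m] (c i)) (hc₁ : ∀ i ω, ‖c i ω‖ ≤ 1)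
    (hd : ∀ i, Measurable[m] (d i)) (hd₁ : ∀ i ω, ‖d i ω‖ ≤ 1)
    (hlaw : ∀ T : Finset ι, μ[fun ω => ∏ i ∈ T, b i ω | m] =ᵐ[μ] fun ω => ∏ i ∈ T, ρ i ω)
    (S : Finset ι) :
    μ[fun ω => ∏ i ∈ S, (b i ω * c i ω + d i ω) | m]
      =ᵐ[μ] fun ω => ∏ i ∈ S, (ρ i ω * c i ω + d i ω) := by
  classical
  let M (T : Finset ι) (ω : Ω) : ℝ := (∏ i ∈ T, c i ω) * ∏ i ∈ S \ T, d i ω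
  have hM (T) : Measurable[m] (M T) :=
    (Finset.measurable_fun_prod _ fun i _ => hc i).mul
      (Finset.measurable_fun_prod _ fun i _ => hd i)
  have hM₁ (T) (ω) : ‖M T ω‖ ≤ 1 := by
    rw [norm_mul]
    exact mul_le_one₀ (norm_finsetProd_le_one (hc₁ · ω) _) (norm_nonneg _)
      (norm_finsetProd_le_one (hd₁ · ω) _)
  have hexpand (a : ι → Ω → ℝ) : (fun ω => ∏ i ∈ S, (a i ω * c i ω + d i ω)) =
      ∑ T ∈ S.powerset, M T * fun ω => ∏ i ∈ T, a i ω := by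
    ext ω
    simp only [Finset.prod_add, Finset.prod_mul_distrib, Finset.sum_apply, Pi.mul_apply, M]
    exact Finset.sum_congr rfl fun T _ => by ring
  have hinteg (T : Finset ι) := integrable_finsetProd_of_norm_le_one (μ := μ) hb hb₁ T
  have hMint (T) : Integrable (M T * fun ω => ∏ i ∈ T, b i ω) μ :=
    (hinteg T).bdd_mul ((hM T).mono hm le_rfl).aestronglyMeasurable
      (Eventually.of_forall (hM₁ T))
  rw [hexpand b, hexpand ρ]
  refine (condExp_finsetSum (fun T _ => hMint T) m).trans ?_
  exact eventuallyEq_sum fun T _ =>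
    (condExp_mul_of_stronglyMeasurable_left (hM T).stronglyMeasurable (hMint T) (hinteg T)).trans
    (EventuallyEq.rfl.mul (hlaw T))

lemma lintegral_finsetProd_ofReal (hb : ∀ i, Measurable (b i))
    (hb₁ : ∀ i ω, b i ω ∈ Icc 0 1) (S : Finset ι) :
    ∫⁻ ω, ∏ i ∈ S, ENNReal.ofReal (b i ω) ∂μ = ENNReal.ofReal (∫ ω, ∏ i ∈ S, b i ω ∂μ) := by
  rw [ofReal_integral_eq_lintegral_ofReal
    (integrable_finsetProd_of_norm_le_one hb
      (fun i ω => (Real.norm_of_nonneg (hb₁ i ω).1).trans_le (hb₁ i ω).2) S)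
    (Eventually.of_forall fun ω => Finset.prod_nonneg fun i _ => (hb₁ i ω).1)]
  exact lintegral_congr fun ω => (ENNReal.ofReal_prod_of_nonneg fun i _ => (hb₁ i ω).1).symm

lemma lintegral_finsetProd_mixture (hm : m ≤ mΩ)
    (hb : ∀ i, Measurable (b i)) (hb₁ : ∀ i ω, b i ω ∈ Icc 0 1)
    (hρ : ∀ i, Measurable (ρ i)) (hρ₁ : ∀ i ω, ρ i ω ∈ Icc 0 1)
    (hp : ∀ i, Measurable[m] (p i)) (hp₁ : ∀ i ω, p i ω ∈ Icc 0 1)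
    (hq : ∀ i, Measurable[m] (q i)) (hq₁ : ∀ i ω, q i ω ∈ Icc 0 1)
    (hlaw : ∀ T : Finset ι, μ[fun ω => ∏ i ∈ T, b i ω | m] =ᵐ[μ] fun ω => ∏ i ∈ T, ρ i ω)
    (S : Finset ι) :
    ∫⁻ ω, ∏ i ∈ S, ENNReal.ofReal (b i ω * p i ω + (1 - b i ω) * q i ω) ∂μ
      = ∫⁻ ω, ∏ i ∈ S, ENNReal.ofReal (ρ i ω * p i ω + (1 - ρ i ω) * q i ω) ∂μ := by
  have hconv {a : ι → Ω → ℝ} (ha : ∀ i, Measurable (a i)) (ha₁ : ∀ i ω, a i ω ∈ Icc 0 1) :=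
    lintegral_finsetProd_ofReal (μ := μ)
      (b := fun i ω => a i ω * p i ω + (1 - a i ω) * q i ω)
      (fun i => ((ha i).mul ((hp i).mono hm le_rfl)).add
        (((ha i).const_sub 1).mul ((hq i).mono hm le_rfl)))
      (fun i ω => convex_Icc 0 1 (hp₁ i ω) (hq₁ i ω) (ha₁ i ω).1 (sub_nonneg.2 (ha₁ i ω).2)
        (add_sub_cancel _ _)) S
  have hnorm {x : ℝ} (hx : x ∈ Icc 0 1) : ‖x‖ ≤ 1 := (Real.norm_of_nonneg hx.1).trans_le hx.2
  have hcond := condExp_finsetProd_mul_add hm hb (fun i ω => hnorm (hb₁ i ω))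
    (c := fun i ω => p i ω - q i ω) (fun i => (hp i).sub (hq i))
    (fun i ω => Real.dist_le_of_mem_Icc_01 (hp₁ i ω) (hq₁ i ω)) hq (fun i ω => hnorm (hq₁ i ω))
    hlaw S
  have hmix (a x y : ℝ) : a * x + (1 - a) * y = a * (x - y) + y := by ring
  rw [hconv hb hb₁, hconv hρ hρ₁]
  simp only [hmix]
  rw [← integral_condExp hm, integral_congr_ae hcond]

end ConditionalMixing

section Network

variable {Ω : Type*} {lam c₁ c₂ α ℓ s t : ℝ} {N : ℕ} {η : Measure ℝ}
  {X : ℕ → Ω → Plane} {H : ℕ → Ω → ℝ} {B : ℕ → Ω → Bool} {G : ℕ → Ω → ℝ}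

/-- The factor `L ‖U‖ ^ (-α)` by which the signal of a UAV is multiplied on its way to the origin,
as a function of the projection, the altitude and the line-of-sight state of the UAV. -/
noncomputable def pathGain (α ℓ : ℝ) (u : Plane × ℝ × Bool) : ℝ :=
  linkFactor ℓ u.2.2 * ‖position u.1 u.2.1‖ ^ (-α)

lemma measurable_pathGain (α ℓ : ℝ) : Measurable (pathGain α ℓ) := by
  have hlink : Measurable (linkFactor ℓ) := Measurable.of_discrete
  exact (hlink.comp (by fun_prop)).mul ((measurable_norm_position_rpow (-α)).comp
    (f := fun u : Plane × ℝ × Bool => (u.1, u.2.1)) (by fun_prop))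

lemma pathGain_nonneg (hℓ : 0 ≤ ℓ) (u : Plane × ℝ × Bool) : 0 ≤ pathGain α ℓ u := by
  have : 0 ≤ linkFactor ℓ u.2.2 := by
    unfold linkFactor
    split_ifs <;> [exact zero_le_one; exact hℓ]
  unfold pathGain
  positivity

lemma signal_eq_pathGain_mul (i : ℕ) (ω : Ω) :
    signal α ℓ X H B G i ω = pathGain α ℓ (X i ω, H i ω, B i ω) * G i ω := by
  rw [signal, pathGain]
  ring

/-- The contribution of UAV `i` to the received signal when the gains are normalised to have mean
`1`. -/
noncomputable def unitSignal (α ℓ : ℝ) (N : ℕ) (X : ℕ → Ω → Plane) (H : ℕ → Ω → ℝ)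
    (B : ℕ → Ω → Bool) (G : ℕ → Ω → ℝ) : ℕ → Ω → ℝ :=
  signal α ℓ X H B fun i ω => G i ω / N

/-- The total received signal when the gains are normalised to have mean `1`; it is `0` where the
series diverges. -/
noncomputable def unitPower (α ℓ : ℝ) (N : ℕ) (X : ℕ → Ω → Plane) (H : ℕ → Ω → ℝ)
    (B : ℕ → Ω → Bool) (G : ℕ → Ω → ℝ) (ω : Ω) : ℝ :=
  ∑' i, unitSignal α ℓ N X H B G i ω

lemma signal_eq_mul_unitSignal (hN : 1 ≤ N) (i : ℕ) (ω : Ω) :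
    signal α ℓ X H B G i ω = N * unitSignal α ℓ N X H B G i ω := by
  have : (N : ℝ) ≠ 0 := Nat.cast_ne_zero.2 (by omega)
  rw [unitSignal, signal_eq_pathGain_mul, signal_eq_pathGain_mul]
  field_simp

lemma tsum_signal_eq_mul_unitPower (hN : 1 ≤ N) (ω : Ω) :
    ∑' i, signal α ℓ X H B G i ω = N * unitPower α ℓ N X H B G ω := by
  simp only [signal_eq_mul_unitSignal hN, tsum_mul_left, unitPower]

lemma ofReal_unitPower (hℓ : 0 ≤ ℓ) {ω : Ω} (hnonneg : ∀ i, 0 ≤ unitSignal α ℓ N X H B G i ω)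
    (hsum : Summable fun i => unitSignal α ℓ N X H B G i ω) :
    ENNReal.ofReal (unitPower α ℓ N X H B G ω) =
      ∑' i, ENNReal.ofReal (pathGain α ℓ (X i ω, H i ω, B i ω) / N) * ENNReal.ofReal (G i ω) := by
  rw [unitPower, ENNReal.ofReal_tsum_of_nonneg hnonneg hsum]
  refine tsum_congr fun i => ?_
  rw [← ENNReal.ofReal_mul (div_nonneg (pathGain_nonneg hℓ _) N.cast_nonneg), unitSignal,
    signal_eq_pathGain_mul, div_mul_eq_mul_div, mul_div_assoc]

namespace IsAPDLNetwork

variable [MeasurableSpace Ω] {μ : Measure Ω} (hnet : IsAPDLNetwork μ lam η c₁ c₂ N X H B G)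
include hnet

lemma measurable_node (i : ℕ) : Measurable fun ω => (X i ω, H i ω, B i ω) :=
  (hnet.projections.measurable i).prodMk
    ((hnet.measurable_altitude i).prodMk (hnet.measurable_los i))

lemma isProbabilityMeasure_altitude [IsProbabilityMeasure μ] : IsProbabilityMeasure η :=
  hnet.altitude_law 0 ▸ Measure.isProbabilityMeasure_map (hnet.measurable_altitude 0).aemeasurable

lemma measurable_unitSignal (i : ℕ) : Measurable (unitSignal α ℓ N X H B G i) := by
  rw [unitSignal, funext (signal_eq_pathGain_mul (α := α) (ℓ := ℓ) i)]
  exact ((measurable_pathGain α ℓ).comp (hnet.measurable_node i)).mul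
    ((hnet.measurable_gain i).div_const _)

lemma measurable_unitPower : Measurable (unitPower α ℓ N X H B G) :=
  Measurable.tsum hnet.measurable_unitSignal

lemma ae_gain_pos : ∀ᵐ ω ∂μ, ∀ i, 0 < G i ω := by
  refine ae_all_iff.2 fun i => ae_of_ae_map (hnet.measurable_gain i).aemeasurable ?_
  rw [hnet.gain_law i]
  exact ae_pos_gammaMeasure N 1

lemma measure_ofReal_gain_eq (i : ℕ) (x : ℝ≥0∞) : μ {ω | ENNReal.ofReal (G i ω) = x} = 0 := by
  have hG : μ {ω | G i ω = x.toReal} = 0 := by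
    have := gammaMeasure_singleton N 1 x.toReal
    rwa [← hnet.gain_law i, Measure.map_apply (hnet.measurable_gain i)
      (measurableSet_singleton _)] at this
  refine measure_mono_null_ae ?_ hG
  filter_upwards [hnet.ae_gain_pos] with ω hpos (hω : ENNReal.ofReal (G i ω) = x)
  exact hω ▸ (ENNReal.toReal_ofReal (hpos i).le).symm

lemma ae_unitSignal_nonneg (hℓ : 0 ≤ ℓ) : ∀ᵐ ω ∂μ, ∀ i, 0 ≤ unitSignal α ℓ N X H B G i ω := by
  filter_upwards [hnet.ae_gain_pos] with ω hω i
  rw [unitSignal, signal_eq_pathGain_mul]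
  exact mul_nonneg (pathGain_nonneg hℓ _) (div_nonneg (hω i).le N.cast_nonneg)

lemma ae_unitPower_nonneg (hℓ : 0 ≤ ℓ) : ∀ᵐ ω ∂μ, 0 ≤ unitPower α ℓ N X H B G ω :=
  (hnet.ae_unitSignal_nonneg hℓ).mono fun _ => tsum_nonneg

variable [IsProbabilityMeasure μ]

lemma lintegral_finsetProd_exp_neg_unitSignal (hℓ : 0 ≤ ℓ) (hN : 1 ≤ N) (hs : 0 ≤ s)
    (S : Finset ℕ) :
    ∫⁻ ω, ∏ i ∈ S, ENNReal.ofReal (Real.exp (-(s * unitSignal α ℓ N X H B G i ω))) ∂μ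
      = ∫⁻ ω, ∏ i ∈ S, ENNReal.ofReal
          (gammaTransform N (s * pathGain α ℓ (X i ω, H i ω, B i ω))) ∂μ := by
  have hk : Measurable (Function.uncurry fun (u : Plane × ℝ × Bool) (g : ℝ) =>
      ENNReal.ofReal (Real.exp (-(s * pathGain α ℓ u * (g / N))))) := by
    have hgain : Measurable fun p : (Plane × ℝ × Bool) × ℝ => pathGain α ℓ p.1 :=
      (measurable_pathGain α ℓ).comp measurable_fst
    exact ((hgain.const_mul s).mul (measurable_snd.div_const _)).neg.exp.ennreal_ofReal
  have hmarks := lintegral_prod_of_indep_marks hnet.measurable_node hnet.measurable_gain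
    hnet.gain_law hnet.gain_indep hnet.gain_indep_rest hk S
  have hgamma (u : Plane × ℝ × Bool) := lintegral_exp_neg_mul_div_gammaMeasure hN
    (mul_nonneg hs (pathGain_nonneg (α := α) hℓ u))
  simp only [hgamma] at hmarks
  simpa only [unitSignal, signal_eq_pathGain_mul, mul_assoc] using hmarks

lemma lintegral_finsetProd_gammaTransform_pathGain (hc₂ : 0 ≤ c₂) (hℓ : 0 ≤ ℓ) (hs : 0 ≤ s)
    (S : Finset ℕ) :
    ∫⁻ ω, ∏ i ∈ S, ENNReal.ofReal
        (gammaTransform N (s * pathGain α ℓ (X i ω, H i ω, B i ω))) ∂μ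
      = ∫⁻ ω, ∏ i ∈ S, ENNReal.ofReal (linkTransform c₁ c₂ ℓ N (elevation (X i ω) (H i ω))
          (s * ‖position (X i ω) (H i ω)‖ ^ (-α))) ∂μ := by
  have hXH : Measurable fun ω i => (X i ω, H i ω) := measurable_pi_iff.2 fun i =>
    (hnet.projections.measurable i).prodMk (hnet.measurable_altitude i)
  have hcoord (i) : Measurable[MeasurableSpace.comap (fun ω i => (X i ω, H i ω)) inferInstance]
      fun ω => (X i ω, H i ω) :=
    (measurable_pi_apply i).comp (comap_measurable fun ω i => (X i ω, H i ω))
  have hdist (i) : Measurable[MeasurableSpace.comap (fun ω i => (X i ω, H i ω)) inferInstance]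
      fun ω => s * ‖position (X i ω) (H i ω)‖ ^ (-α) :=
    ((measurable_norm_position_rpow (-α)).comp (hcoord i)).const_mul s
  have hpos (i ω) : 0 ≤ s * ‖position (X i ω) (H i ω)‖ ^ (-α) := by positivity
  have hmix := lintegral_finsetProd_mixture hXH.comap_le
    (b := fun i ω => if B i ω then (1 : ℝ) else 0)
    (ρ := fun i ω => losProb c₁ c₂ (elevation (X i ω) (H i ω)))
    (p := fun i ω => gammaTransform N (s * ‖position (X i ω) (H i ω)‖ ^ (-α)))
    (q := fun i ω => gammaTransform N (s * ‖position (X i ω) (H i ω)‖ ^ (-α) * ℓ))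
    (fun i => (Measurable.of_discrete (f := fun b : Bool => if b then (1 : ℝ) else 0)).comp
      (hnet.measurable_los i))
    (fun i ω => by split_ifs <;> simp)
    (fun i => (measurable_losProb c₁ c₂).comp (measurable_elevation.comp
      ((hnet.projections.measurable i).prodMk (hnet.measurable_altitude i))))
    (fun i ω => losProb_mem_Icc hc₂ _)
    (fun i => (measurable_gammaTransform N).comp (hdist i))
    (fun i ω => gammaTransform_mem_Icc N (hpos i ω))
    (fun i => (measurable_gammaTransform N).comp ((hdist i).mul_const ℓ))
    (fun i ω => gammaTransform_mem_Icc N (mul_nonneg (hpos i ω) hℓ)) hnet.los_law S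
  refine Eq.trans (lintegral_congr fun ω => Finset.prod_congr rfl fun i _ => ?_) hmix
  cases B i ω <;> simp [pathGain, linkFactor, mul_assoc, mul_comm ℓ]

lemma lintegral_finsetProd_linkTransform (s : ℝ) (S : Finset ℕ) :
    ∫⁻ ω, ∏ i ∈ S, ENNReal.ofReal (linkTransform c₁ c₂ ℓ N (elevation (X i ω) (H i ω))
        (s * ‖position (X i ω) (H i ω)‖ ^ (-α))) ∂μ
      = ∫⁻ ω, ∏ i ∈ S, nodeTransform c₁ c₂ α ℓ N η s (X i ω) ∂μ :=
  lintegral_prod_of_indep_marks hnet.projections.measurable hnet.measurable_altitude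
    hnet.altitude_law hnet.altitude_indep hnet.altitude_projection_indep
    (k := fun x h => ENNReal.ofReal
      (linkTransform c₁ c₂ ℓ N (elevation x h) (s * ‖position x h‖ ^ (-α))))
    (measurable_linkTransform_position c₁ c₂ α ℓ N s).ennreal_ofReal S

lemma lintegral_tprod_exp_neg_unitSignal (hc₂ : 0 ≤ c₂) (hℓ : 0 ≤ ℓ) (hN : 1 ≤ N) (hs : 0 ≤ s) :
    ∫⁻ ω, ∏' i, ENNReal.ofReal (Real.exp (-(s * unitSignal α ℓ N X H B G i ω))) ∂μ
      = ∫⁻ ω, ∏' i, nodeTransform c₁ c₂ α ℓ N η s (X i ω) ∂μ := by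
  have := hnet.isProbabilityMeasure_altitude
  refine tendsto_nhds_unique (tendsto_lintegral_finsetProd (fun i =>
    ((hnet.measurable_unitSignal i).const_mul s).neg.exp.ennreal_ofReal) ?_) ?_
  · filter_upwards [hnet.ae_unitSignal_nonneg hℓ] with ω hω i
    exact ENNReal.ofReal_le_one.2 (Real.exp_le_one_iff.2 (neg_nonpos.2 (mul_nonneg hs (hω i))))
  · simp only [hnet.lintegral_finsetProd_exp_neg_unitSignal hℓ hN hs,
      hnet.lintegral_finsetProd_gammaTransform_pathGain hc₂ hℓ hs,
      hnet.lintegral_finsetProd_linkTransform]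
    exact tendsto_lintegral_finsetProd
      (fun i => measurable_nodeTransform.comp (hnet.projections.measurable i))
      (Eventually.of_forall fun ω i => nodeTransform_le_one hc₂ hℓ hs (X i ω))

lemma lintegral_tprod_exp_neg_unitSignal_eq_exp_JG (hlam : 0 ≤ lam) (hc₂ : 0 ≤ c₂) (hα : 2 < α)
    (hℓ : 0 ≤ ℓ) (hN : 1 ≤ N) (hs : 0 ≤ s) :
    ∫⁻ ω, ∏' i, ENNReal.ofReal (Real.exp (-(s * unitSignal α ℓ N X H B G i ω))) ∂μ
      = ENNReal.ofReal (Real.exp (-(Real.pi * lam * ∫ z in Ioi (0 : ℝ),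
          JG c₁ c₂ α ℓ N (s * z ^ (-(α / 2))) (angleLaw η z)))) := by
  have := hnet.isProbabilityMeasure_altitude
  have hinteg := lintegral_one_sub_nodeTransform (c₁ := c₁) (N := N) (η := η) hlam hc₂ hα hℓ hs
  have hnonneg : 0 ≤ ∫ z in Ioi (0 : ℝ), JG c₁ c₂ α ℓ N (s * z ^ (-(α / 2))) (angleLaw η z) :=
    setIntegral_nonneg measurableSet_Ioi fun z hz => JG_angleLaw_nonneg hc₂ hℓ hs (le_of_lt hz)
  rw [hnet.lintegral_tprod_exp_neg_unitSignal hc₂ hℓ hN hs,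
    hnet.projections.lintegral_tprod measurable_nodeTransform (nodeTransform_le_one hc₂ hℓ hs)
      (hinteg ▸ ENNReal.ofReal_ne_top), hinteg, ENNReal.toReal_ofReal (by positivity)]

lemma ae_summable_unitSignal (hlam : 0 ≤ lam) (hc₂ : 0 ≤ c₂) (hα : 2 < α) (hℓ : 0 ≤ ℓ)
    (hN : 1 ≤ N) : ∀ᵐ ω ∂μ, Summable fun i => unitSignal α ℓ N X H B G i ω := by
  have := hnet.isProbabilityMeasure_altitude
  refine ae_summable_of_tendsto_lintegral_tprod_exp_neg hnet.measurable_unitSignal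
    (hnet.ae_unitSignal_nonneg hℓ) ?_
  have hlim : Tendsto (fun s => ENNReal.ofReal (Real.exp (-(Real.pi * lam * ∫ z in Ioi (0 : ℝ),
      JG c₁ c₂ α ℓ N (s * z ^ (-(α / 2))) (angleLaw η z))))) (𝓝[>] 0) (𝓝 1) := by
    have := ((tendsto_integral_JG_angleLaw (c₁ := c₁) (N := N) (η := η) hc₂ hα hℓ).const_mul
      (Real.pi * lam)).neg.rexp
    simpa using ENNReal.tendsto_ofReal this
  refine hlim.congr' ?_
  filter_upwards [self_mem_nhdsWithin] with s hs
  exact (hnet.lintegral_tprod_exp_neg_unitSignal_eq_exp_JG hlam hc₂ hα hℓ hN (le_of_lt hs)).symm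

lemma integral_exp_neg_map_unitPower (hlam : 0 ≤ lam) (hc₂ : 0 ≤ c₂) (hα : 2 < α) (hℓ : 0 ≤ ℓ)
    (hN : 1 ≤ N) (hs : 0 ≤ s) :
    ∫ x, Real.exp (-(s * x)) ∂(μ.map (unitPower α ℓ N X H B G)) =
      Real.exp (-(Real.pi * lam * ∫ z in Ioi (0 : ℝ),
        JG c₁ c₂ α ℓ N (s * z ^ (-(α / 2))) (angleLaw η z))) := by
  have hZ := hnet.measurable_unitPower (α := α) (ℓ := ℓ)
  have hexp : Measurable fun ω => Real.exp (-(s * unitPower α ℓ N X H B G ω)) :=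
    (hZ.const_mul s).neg.exp
  have htprod : ∀ᵐ ω ∂μ, ENNReal.ofReal (Real.exp (-(s * unitPower α ℓ N X H B G ω))) =
      ∏' i, ENNReal.ofReal (Real.exp (-(s * unitSignal α ℓ N X H B G i ω))) := by
    filter_upwards [hnet.ae_summable_unitSignal hlam hc₂ hα hℓ hN] with ω hω
    rw [tprod_ofReal_exp_neg (hω.mul_left s), tsum_mul_left, unitPower]
  rw [integral_map hZ.aemeasurable (by fun_prop), integral_eq_lintegral_of_nonneg_ae
      (Eventually.of_forall fun ω => (Real.exp_pos _).le)
      hexp.aestronglyMeasurable, lintegral_congr_ae htprod,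
    hnet.lintegral_tprod_exp_neg_unitSignal_eq_exp_JG hlam hc₂ hα hℓ hN hs,
    ENNReal.toReal_ofReal (Real.exp_pos _).le]

lemma measure_unitPower_eq (hlam : 0 ≤ lam) (hc₂ : 0 ≤ c₂) (hα : 2 < α) (hℓ : 0 ≤ ℓ)
    (hN : 1 ≤ N) (ht : 0 < t) : μ {ω | unitPower α ℓ N X H B G ω = t} = 0 := by
  have hgain : Measurable fun u => ENNReal.ofReal (pathGain α ℓ u / N) :=
    ((measurable_pathGain α ℓ).div_const _).ennreal_ofReal
  have hgains : Measurable fun (u : ℕ → Plane × ℝ × Bool) i =>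
      ENNReal.ofReal (pathGain α ℓ (u i) / N) :=
    measurable_pi_iff.2 fun i => hgain.comp (measurable_pi_apply i)
  have hfadings : Measurable fun (g : ℕ → ℝ) i => ENNReal.ofReal (g i) :=
    measurable_pi_iff.2 fun i => (measurable_pi_apply i).ennreal_ofReal
  have hatom : μ {ω | ∑' i, ENNReal.ofReal (pathGain α ℓ (X i ω, H i ω, B i ω) / N) *
      ENNReal.ofReal (G i ω) = ENNReal.ofReal t} = 0 :=
    measure_tsum_mul_eq_zero (fun i => hgain.comp (hnet.measurable_node i))
      (fun i => (hnet.measurable_gain i).ennreal_ofReal)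
      (hnet.gain_indep_rest.comp hgains hfadings)
      (hnet.gain_indep.comp _ fun _ => ENNReal.measurable_ofReal) hnet.measure_ofReal_gain_eq
      (ENNReal.ofReal_pos.2 ht).ne' ENNReal.ofReal_ne_top
  refine measure_mono_null_ae ?_ hatom
  filter_upwards [hnet.ae_summable_unitSignal hlam hc₂ hα hℓ hN, hnet.ae_unitSignal_nonneg hℓ]
    with ω hsum hnonneg (hω : unitPower α ℓ N X H B G ω = t)
  exact hω ▸ (ofReal_unitPower hℓ hnonneg hsum).symm

lemma isInverseLaplace_cdf_unitPower (hlam : 0 ≤ lam) (hc₂ : 0 ≤ c₂) (hα : 2 < α) (hℓ : 0 ≤ ℓ)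
    (hN : 1 ≤ N) : IsInverseLaplace (coverageTransform lam η c₁ c₂ α ℓ N)
      (cdf (μ.map (unitPower α ℓ N X H B G))) := by
  have hZ := hnet.measurable_unitPower (α := α) (ℓ := ℓ)
  have := Measure.isProbabilityMeasure_map (μ := μ) hZ.aemeasurable
  refine (isInverseLaplace_cdf ((ae_map_iff hZ.aemeasurable measurableSet_Ici).2
    (hnet.ae_unitPower_nonneg hℓ)) fun t ht => ?_).congr fun s hs => ?_
  · rw [Measure.map_apply hZ (measurableSet_singleton t)]
    exact hnet.measure_unitPower_eq hlam hc₂ hα hℓ hN ht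
  · simp only [hnet.integral_exp_neg_map_unitPower hlam hc₂ hα hℓ hN (le_of_lt hs),
      coverageTransform]

lemma measureReal_le_unitPower (hlam : 0 ≤ lam) (hc₂ : 0 ≤ c₂) (hα : 2 < α) (hℓ : 0 ≤ ℓ)
    (hN : 1 ≤ N) (ht : 0 < t) : μ.real {ω | t ≤ unitPower α ℓ N X H B G ω} =
      1 - inverseLaplace (coverageTransform lam η c₁ c₂ α ℓ N) t := by
  have hcdf := hnet.isInverseLaplace_cdf_unitPower hlam hc₂ hα hℓ hN
  rw [measureReal_le_eq_one_sub_cdf hnet.measurable_unitPower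
      (hnet.measure_unitPower_eq hlam hc₂ hα hℓ hN ht),
    hcdf.eqOn hcdf.isInverseLaplace_inverseLaplace ht]

end IsAPDLNetwork

end Network

section Coverage

variable {Ω : Type*} [MeasurableSpace Ω] {μ : Measure Ω} {P σ₀ β α ℓ : ℝ} {N : ℕ}
  {X : ℕ → Ω → Plane} {H : ℕ → Ω → ℝ} {B : ℕ → Ω → Bool} {G : ℕ → Ω → ℝ}

lemma cellFreeCoverage_div_eq (hP : 0 < P) (hσ₀ : 0 < σ₀) :
    cellFreeCoverage μ P σ₀ β α ℓ X H B (fun i ω => G i ω / N) =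
      μ.real {ω | β * σ₀ / P ≤ unitPower α ℓ N X H B G ω} := by
  refine congrArg μ.real (Set.ext fun ω => ?_)
  change β ≤ P * unitPower α ℓ N X H B G ω / σ₀ ↔ β * σ₀ / P ≤ unitPower α ℓ N X H B G ω
  rw [le_div_iff₀ hσ₀, div_le_iff₀' hP]

lemma cellFreeCoverage_eq (hP : 0 < P) (hσ₀ : 0 < σ₀) (hN : 1 ≤ N) :
    cellFreeCoverage μ P σ₀ β α ℓ X H B G =
      μ.real {ω | β * σ₀ / (N * P) ≤ unitPower α ℓ N X H B G ω} := by
  have hNP : 0 < N * P := mul_pos (Nat.cast_pos.2 hN) hP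
  refine congrArg μ.real (Set.ext fun ω => ?_)
  simp only [tsum_signal_eq_mul_unitPower hN, mem_ofPred_eq, ge_iff_le]
  rw [le_div_iff₀ hσ₀, div_le_iff₀' hNP, mul_left_comm, mul_assoc]

end Coverage

theorem proposition4_general {Ω : Type*} [MeasurableSpace Ω] (μ : Measure Ω)
    [IsProbabilityMeasure μ] (lam c₁ c₂ α ℓ P σ₀ β : ℝ) (N : ℕ) (η : Measure ℝ)
    (X : ℕ → Ω → Plane) (H : ℕ → Ω → ℝ) (B : ℕ → Ω → Bool) (G : ℕ → Ω → ℝ)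
    (hlam : 0 ≤ lam) (hc₂ : 0 ≤ c₂) (hα : 2 < α) (hℓ : 0 ≤ ℓ)
    (hP : 0 < P) (hσ₀ : 0 < σ₀) (hβ : 0 < β) (hN : 1 ≤ N)
    (hnet : IsAPDLNetwork μ lam η c₁ c₂ N X H B G) :
    (∀ᵐ ω ∂μ, Summable fun i => signal α ℓ X H B G i ω) ∧
    (∀ s > 0, IntegrableOn
      (fun z => JG c₁ c₂ α ℓ N (s * z ^ (-(α / 2))) (angleLaw η z)) (Ioi 0)) ∧
    IsInverseLaplace (coverageTransform lam η c₁ c₂ α ℓ N)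
      (inverseLaplace (coverageTransform lam η c₁ c₂ α ℓ N)) ∧
    cellFreeCoverage μ P σ₀ β α ℓ X H B (fun i ω => G i ω / N) =
      1 - inverseLaplace (coverageTransform lam η c₁ c₂ α ℓ N) (β * σ₀ / P) ∧
    cellFreeCoverage μ P σ₀ β α ℓ X H B G =
      1 - inverseLaplace (coverageTransform lam η c₁ c₂ α ℓ N) (β * σ₀ / (N * P)) ∧
    (∀ x : ℝ, 0 ≤ x → ∀ ν : Measure ℝ, IsProbabilityMeasure ν →
      (∀ᵐ y ∂ν, y ∈ Icc 0 (Real.pi / 2)) →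
      Tendsto (fun n : ℕ => JG c₁ c₂ α ℓ n x ν) atTop
        (𝓝 (1 - ∫ y, (losProb c₁ c₂ y * Real.exp (-(x * Real.cos y ^ α))
          + (1 - losProb c₁ c₂ y) * Real.exp (-(x * ℓ * Real.cos y ^ α))) ∂ν))) := by
  have := hnet.isProbabilityMeasure_altitude
  have : (0 : ℝ) < N := Nat.cast_pos.2 hN
  refine ⟨?_, fun s hs => integrableOn_JG_angleLaw hc₂ hα hℓ hs.le,
    (hnet.isInverseLaplace_cdf_unitPower hlam hc₂ hα hℓ hN).isInverseLaplace_inverseLaplace,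
    ?_, ?_, fun x hx ν _ hν => tendsto_JG hc₂ hℓ hx (hν.mono fun y hy =>
      Real.cos_nonneg_of_mem_Icc ⟨by linarith [hy.1, Real.pi_pos], hy.2⟩)⟩
  · simp only [signal_eq_mul_unitSignal hN]
    exact (hnet.ae_summable_unitSignal hlam hc₂ hα hℓ hN).mono fun ω hω => hω.mul_left _
  · rw [cellFreeCoverage_div_eq hP hσ₀,
      hnet.measureReal_le_unitPower hlam hc₂ hα hℓ hN (by positivity)]
  · rw [cellFreeCoverage_eq hP hσ₀ hN,
      hnet.measureReal_le_unitPower hlam hc₂ hα hℓ hN (by positivity)]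

end CellFree

theorem proposition4 {Ω : Type*} [MeasurableSpace Ω] (μ : Measure Ω) [IsProbabilityMeasure μ]
    (lam c₁ c₂ α ℓ P σ₀ β : ℝ) (N : ℕ) (η : Measure ℝ)
    (X : ℕ → Ω → Plane) (H : ℕ → Ω → ℝ) (B : ℕ → Ω → Bool) (G : ℕ → Ω → ℝ)
    (hlam : 0 < lam) (hc₁ : 0 < c₁) (hc₂ : 0 < c₂) (hα : 2 < α) (hℓ : ℓ ∈ Icc (0 : ℝ) 1)
    (hP : 0 < P) (hσ₀ : 0 < σ₀) (hβ : 0 < β) (hN : 1 ≤ N)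
    (hnet : IsAPDLNetwork μ lam η c₁ c₂ N X H B G) :
    -- the received signal is almost surely finite
    (∀ᵐ ω ∂μ, Summable fun i => signal α ℓ X H B G i ω) ∧
    -- the integral in the exponent converges
    (∀ s > 0, IntegrableOn
      (fun z => JG c₁ c₂ α ℓ N (s * z ^ (-(α / 2))) (angleLaw η z)) (Ioi 0)) ∧
    -- the inverse Laplace transform exists
    IsInverseLaplace (coverageTransform lam η c₁ c₂ α ℓ N)
      (inverseLaplace (coverageTransform lam η c₁ c₂ α ℓ N)) ∧
    -- coverage with the gains `G i / N` of unit mean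
    cellFreeCoverage μ P σ₀ β α ℓ X H B (fun i ω => G i ω / N) =
      1 - inverseLaplace (coverageTransform lam η c₁ c₂ α ℓ N) (β * σ₀ / P) ∧
    -- coverage with the gains `G i` themselves
    cellFreeCoverage μ P σ₀ β α ℓ X H B G =
      1 - inverseLaplace (coverageTransform lam η c₁ c₂ α ℓ N) (β * σ₀ / (N * P)) ∧
    -- the limit of a large number of antennas
    (∀ x : ℝ, 0 ≤ x → ∀ ν : Measure ℝ, IsProbabilityMeasure ν →
      (∀ᵐ y ∂ν, y ∈ Icc 0 (Real.pi / 2)) →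
      Tendsto (fun n : ℕ => JG c₁ c₂ α ℓ n x ν) atTop
        (𝓝 (1 - ∫ y, (losProb c₁ c₂ y * Real.exp (-(x * Real.cos y ^ α))
          + (1 - losProb c₁ c₂ y) * Real.exp (-(x * ℓ * Real.cos y ^ α))) ∂ν))) := by
  exact proposition4_general μ lam c₁ c₂ α ℓ P σ₀ β N η X H B G hlam.le hc₂.le hα hℓ.1 hP hσ₀ hβ hN
    hnet
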